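/- Let $\Delta<0$ be a fundamental discriminant, let $\left(\frac{\Delta}{\cdot}\right)$ be the Kronecker symbol, let $K=\mathbb{Q}(\sqrt{\Delta})\subset\mathbb{C}$ with ring of integers $\mathcal{O}_K$, and let $H=H(\Delta)$ be the (finite) set of $\mathrm{SL}_2(\mathbb{Z})$-equivalence classes of positive definite integral binary quadratic forms $Q(x,y)=ax^2+bxy+cy^2$ with $b^2-4ac=\Delta$. For $h\in H$ let $Q_h$ be a form in $h$, let $r(Q_h,n)=\#\{(x,y)\in\mathbb{Z}^2: Q_h(x,y)=n\}$, and let $\Theta_h=\sum_{n\ge 0} r(Q_h,n)q^n\in\mathbb{Z}[[q]]$. Put $$a(n)=\sum_{h\in H} r(Q_h,n)\qquad (n\ge 0),$$ with $a(n/p)=0$ if $p\nmid n$. For a prime $p$ and a formal power series $f=\sum_{n\ge0} c(n)q^n$ put $$f|U_p=\sum_{n\ge 0} c(pn)q^n,\qquad f|V_p=\sum_{n\ge 0}c(n)q^{pn},\qquad f|T_p=f|U_p+\left(\tfrac{\Delta}{p}\right)f|V_p.$$ Let $w=4$ if $\Delta=-4$, $w=6$ if $\Delta=-3$, and $w=2$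 if $\Delta<-4$. Then: 1. For every prime $p$ and every integer $n\ge 0$, $$a(pn)+\left(\tfrac{\Delta}{p}\right)a(n/p)=\left(1+\left(\tfrac{\Delta}{p}\right)\right)a(n).$$ 2. The series $\sum_{h\in H}\Theta_h$ is non-zero, and for every prime $p$, $$\Big(\sum_{h\in H}\Theta_h\Big)\Big|T_p=\left(1+\left(\tfrac{\Delta}{p}\right)\right)\sum_{h\in H}\Theta_h .$$ 3. (Gauss) For every $n\ge 1$, $\displaystyle a(n)=w\sum_{t\mid n}\left(\tfrac{\Delta}{t}\right)$. 4. There is a bijection from the ideal class group of $\mathcal{O}_K$ onto $H$ which sends the class of each non-zero ideal $I$ to the class consisting of exactly the forms $N(\alpha x+\beta y)/N(I)$, where $(\alpha,\beta)$ runs through the $\mathbb{Z}$-bases of $I$ with $\mathrm{Im}(\beta/\alpha)>0$. For $h\in H$ and a non-zero ideal $\mathfrak{q}$, let $h\mathfrak{q}\in H$ be the image of the product of the ideal class corresponding to $h$ with the class of $\mathfrak{q}$. Then for every prime $p$ and every $h\in H$: - if $(p)=\mathfrak{p}\mathfrak{p}'$ with distinct prime ideals $\mathfrak{p},\mathfrak{p}'$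 ($p$ splits), then $\Theta_h|T_p=\Theta_{h\mathfrak{p}}+\Theta_{h\mathfrak{p}'}$; - if $(p)=\mathfrak{p}^2$ with a prime ideal $\mathfrak{p}$ ($p$ ramifies), then $\Theta_h|T_p=\Theta_h|U_p=\Theta_{h\mathfrak{p}}$; - if $(p)$ is a prime ideal ($p$ is inert), then $\Theta_h|T_p=0$. -/

import Mathlib

open scoped NumberField nonZeroDivisors

noncomputable section

namespace HeckeTheta

/-- Fundamental discriminants: the discriminants of quadratic fields, together with `1`. -/
def IsFundamentalDiscriminant (D : ℤ) : Prop :=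
  (D % 4 = 1 ∧ Squarefree D) ∨ ∃ m : ℤ, D = 4 * m ∧ (m % 4 = 2 ∨ m % 4 = 3) ∧ Squarefree m

/-- The Kronecker symbol `(D / n)` for `n ≥ 0`. Note that `ZMod.χ₈ D` is `(D / 2)`: it is `0` for
even `D`, `1` for `D ≡ ±1 mod 8` and `-1` for `D ≡ ±3 mod 8`. -/
def kroneckerSym (D : ℤ) (n : ℕ) : ℤ :=
  if n = 0 then (if D.natAbs = 1 then 1 else 0)
  else ZMod.χ₈ (D : ZMod 8) ^ n.factorization 2 * jacobiSym D (n / 2 ^ n.factorization 2)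

/-- Positive definite integral binary quadratic forms `[a, b, c] = a x² + b x y + c y²`
of discriminant `D`. -/
@[ext]
structure PosForm (D : ℤ) where
  a : ℤ
  b : ℤ
  c : ℤ
  disc_eq : b ^ 2 - 4 * a * c = D
  pos : ∀ x y : ℤ, (x, y) ≠ (0, 0) → 0 < a * x ^ 2 + b * x * y + c * y ^ 2

namespace PosForm

variable {D : ℤ}

/-- The value `Q(x, y)`. -/
def eval (Q : PosForm D) (x y : ℤ) : ℤ := Q.a * x ^ 2 + Q.b * x * y + Q.c * y ^ 2

/-- Proper equivalence: `Q'` arises from `Q` by a substitution in `SL₂(ℤ)`. -/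
def Equivalent (Q Q' : PosForm D) : Prop :=
  ∃ g : Matrix.SpecialLinearGroup (Fin 2) ℤ, ∀ x y : ℤ,
    Q'.eval x y = Q.eval (g.1 0 0 * x + g.1 0 1 * y) (g.1 1 0 * x + g.1 1 1 * y)

theorem det_eq (g : Matrix.SpecialLinearGroup (Fin 2) ℤ) :
    g.1 0 0 * g.1 1 1 - g.1 0 1 * g.1 1 0 = 1 := by
  have := g.2
  rwa [Matrix.det_fin_two] at this

theorem Equivalent.refl (Q : PosForm D) : Q.Equivalent Q := ⟨1, by simp⟩

theorem Equivalent.symm {Q Q' : PosForm D} (h : Q.Equivalent Q') : Q'.Equivalent Q := by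
  obtain ⟨g, hg⟩ := h
  have hd := det_eq g
  refine ⟨g⁻¹, fun x y => ?_⟩
  rw [hg]
  simp only [Matrix.SpecialLinearGroup.coe_inv, Matrix.adjugate_fin_two, Matrix.of_apply,
    Matrix.cons_val', Matrix.cons_val_zero, Matrix.cons_val_one, Matrix.cons_val_fin_one]
  congr 1
  · linear_combination (-x) * hd
  · linear_combination (-y) * hd

theorem Equivalent.trans {Q Q' Q'' : PosForm D} (h : Q.Equivalent Q') (h' : Q'.Equivalent Q'') :
    Q.Equivalent Q'' := by
  obtain ⟨g, hg⟩ := h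
  obtain ⟨k, hk⟩ := h'
  refine ⟨g * k, fun x y => ?_⟩
  rw [hk, hg]
  simp only [Matrix.SpecialLinearGroup.coe_mul, Matrix.mul_apply, Fin.sum_univ_two]
  congr 1 <;> ring

instance setoid (D : ℤ) : Setoid (PosForm D) where
  r := Equivalent
  iseqv := ⟨Equivalent.refl, Equivalent.symm, Equivalent.trans⟩

theorem a_pos (Q : PosForm D) : 0 < Q.a := by simpa using Q.pos 1 0 (by simp)

theorem c_pos (Q : PosForm D) : 0 < Q.c := by simpa using Q.pos 0 1 (by simp)

/-- The number `r(Q, n)` of representations of `n` by `Q`. -/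
def rep (Q : PosForm D) (n : ℕ) : ℕ := Nat.card {v : ℤ × ℤ // Q.eval v.1 v.2 = n}

theorem disc_neg (Q : PosForm D) : D < 0 := by
  have h := Q.pos (-Q.b) (2 * Q.a) (by have := Q.a_pos; simp; omega)
  have ha := Q.a_pos
  have hd := Q.disc_eq
  by_contra hD
  have : 0 ≤ Q.a * D := mul_nonneg ha.le (by omega)
  have e : Q.a * D = Q.a * (Q.b ^ 2 - 4 * Q.a * Q.c) := congrArg (Q.a * ·) hd.symm
  nlinarith

theorem four_a_eval (Q : PosForm D) (x y : ℤ) :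
    4 * Q.a * Q.eval x y = (2 * Q.a * x + Q.b * y) ^ 2 + (-D) * y ^ 2 := by
  rw [eval]; linear_combination (-y ^ 2) * Q.disc_eq

/-- The number of representations is an honest (finite) count. -/
theorem finite_rep (Q : PosForm D) (n : ℕ) : Finite {v : ℤ × ℤ // Q.eval v.1 v.2 = n} := by
  have ha := Q.a_pos
  have hD := Q.disc_neg
  set M : ℤ := 4 * Q.a * n with hM
  have hfin : ((Set.Icc (-M) M) ×ˢ (Set.Icc (-M) M) : Set (ℤ × ℤ)).Finite :=
    (Set.finite_Icc _ _).prod (Set.finite_Icc _ _)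
  have := hfin.to_subtype
  have key : ∀ v : {v : ℤ × ℤ // Q.eval v.1 v.2 = n},
      (2 * Q.a * v.1.1 + Q.b * v.1.2, v.1.2) ∈
        ((Set.Icc (-M) M) ×ˢ (Set.Icc (-M) M) : Set (ℤ × ℤ)) := by
    rintro ⟨⟨x, y⟩, hv⟩
    have h := Q.four_a_eval x y
    simp only at hv
    rw [hv, ← hM] at h
    have hy : y ^ 2 ≤ M := by nlinarith [sq_nonneg (2 * Q.a * x + Q.b * y), sq_nonneg y]
    have hx : (2 * Q.a * x + Q.b * y) ^ 2 ≤ M := by nlinarith [sq_nonneg y]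
    have hs : ∀ z : ℤ, z ^ 2 ≤ M → z ∈ Set.Icc (-M) M := by
      intro z hz
      have h1 : |z| ≤ z ^ 2 := by
        rw [← sq_abs]; exact Int.le_self_sq _
      exact abs_le.mp (h1.trans hz)
    exact ⟨hs _ hx, hs _ hy⟩
  refine Finite.of_injective (fun v => (⟨_, key v⟩ :
    ((Set.Icc (-M) M) ×ˢ (Set.Icc (-M) M) : Set (ℤ × ℤ)))) ?_
  rintro ⟨⟨x, y⟩, hv⟩ ⟨⟨x', y'⟩, hv'⟩ h
  simp only [Subtype.mk.injEq, Prod.mk.injEq] at h ⊢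
  obtain ⟨h1, rfl⟩ := h
  refine ⟨?_, rfl⟩
  have : 2 * Q.a * x = 2 * Q.a * x' := by linarith
  exact mul_left_cancel₀ (by omega) this

theorem rep_congr {Q Q' : PosForm D} (h : Q ≈ Q') (n : ℕ) : Q.rep n = Q'.rep n := by
  obtain ⟨g, hg⟩ := h
  have hd := det_eq g
  symm
  refine Nat.card_congr (Equiv.subtypeEquiv
    { toFun := fun v => (g.1 0 0 * v.1 + g.1 0 1 * v.2, g.1 1 0 * v.1 + g.1 1 1 * v.2)
      invFun := fun v => (g.1 1 1 * v.1 - g.1 0 1 * v.2, -g.1 1 0 * v.1 + g.1 0 0 * v.2)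
      left_inv := fun v => ?_
      right_inv := fun v => ?_ } fun v => ?_)
  · ext
    · simp only; linear_combination v.1 * hd
    · simp only; linear_combination v.2 * hd
  · ext
    · simp only; linear_combination v.1 * hd
    · simp only; linear_combination v.2 * hd
  · simp [hg]

/-- The substitution `(x, y) ↦ (x + k y, y)`. -/
theorem exists_translate (Q : PosForm D) (k : ℤ) :
    ∃ Q' : PosForm D, Q.Equivalent Q' ∧ Q'.a = Q.a ∧ Q'.b = Q.b + 2 * Q.a * k := by
  refine ⟨⟨Q.a, Q.b + 2 * Q.a * k, Q.a * k ^ 2 + Q.b * k + Q.c, ?_, fun x y h => ?_⟩,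
    ⟨⟨!![1, k; 0, 1], by simp [Matrix.det_fin_two]⟩, fun x y => ?_⟩, rfl, rfl⟩
  · linear_combination Q.disc_eq
  · have := Q.pos (x + k * y) y (by
      intro h0; apply h
      simp only [Prod.mk.injEq] at h0 ⊢
      obtain ⟨h1, rfl⟩ := h0
      exact ⟨by simpa using h1, rfl⟩)
    linarith
  · simp [eval]; ring

/-- The substitution `(x, y) ↦ (-y, x)`. -/
theorem exists_swap (Q : PosForm D) :
    ∃ Q' : PosForm D, Q.Equivalent Q' ∧ Q'.a = Q.c := by
  refine ⟨⟨Q.c, -Q.b, Q.a, ?_, fun x y h => ?_⟩,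
    ⟨⟨!![0, -1; 1, 0], by simp [Matrix.det_fin_two]⟩, fun x y => ?_⟩, rfl⟩
  · linear_combination Q.disc_eq
  · have := Q.pos (-y) x (by
      intro h0; apply h
      simp only [Prod.mk.injEq] at h0 ⊢
      omega)
    linarith
  · simp [eval]; ring

theorem exists_reduced (Q : PosForm D) :
    ∃ Q' : PosForm D, Q.Equivalent Q' ∧ |Q'.b| ≤ Q'.a ∧ Q'.a ≤ Q'.c := by
  classical
  have hex : ∃ m : ℕ, ∃ Q' : PosForm D, Q.Equivalent Q' ∧ Q'.a.toNat = m :=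
    ⟨_, Q, Equivalent.refl Q, rfl⟩
  obtain ⟨Q₁, h₁, hm⟩ := Nat.find_spec hex
  have hmin : ∀ Q' : PosForm D, Q.Equivalent Q' → Q₁.a ≤ Q'.a := by
    intro Q' h'
    have h2 := Nat.find_min' hex ⟨Q', h', rfl⟩
    have := Q'.a_pos
    have := Q₁.a_pos
    omega
  have ha := Q₁.a_pos
  obtain ⟨Q₂, h₂, ha₂, hb₂⟩ := Q₁.exists_translate (-((Q₁.b + Q₁.a) / (2 * Q₁.a)))
  obtain ⟨Q₃, h₃, ha₃⟩ := Q₂.exists_swap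
  refine ⟨Q₂, h₁.trans h₂, ?_, ?_⟩
  · have e := Int.emod_add_mul_ediv (Q₁.b + Q₁.a) (2 * Q₁.a)
    have l := Int.emod_nonneg (Q₁.b + Q₁.a) (by omega : 2 * Q₁.a ≠ 0)
    have u := Int.emod_lt_of_pos (Q₁.b + Q₁.a) (by omega : 0 < 2 * Q₁.a)
    rw [ha₂, hb₂, abs_le]
    constructor <;> linarith
  · rw [ha₂, ← ha₃]
    exact hmin _ ((h₁.trans h₂).trans h₃)

end PosForm

/-- The set `H(D)` of `SL₂(ℤ)`-classes of positive definite binary quadratic forms of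
discriminant `D`. -/
abbrev FormClass (D : ℤ) : Type := Quotient (PosForm.setoid D)

instance FormClass.finite (D : ℤ) : Finite (FormClass D) := by
  set S : Set (ℤ × ℤ × ℤ) :=
    Set.Icc 0 (-D) ×ˢ Set.Icc D (-D) ×ˢ Set.Icc 0 (D ^ 2 - D)
  have hS : S.Finite :=
    (Set.finite_Icc _ _).prod ((Set.finite_Icc _ _).prod (Set.finite_Icc _ _))
  let R := {Q : PosForm D // (Q.a, Q.b, Q.c) ∈ S}
  have := hS.to_subtype
  have hR : Finite R := by
    refine Finite.of_injective (fun Q : R => (⟨_, Q.2⟩ : S)) ?_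
    rintro ⟨Q, _⟩ ⟨Q', _⟩ h
    simp only [Subtype.mk.injEq, Prod.mk.injEq] at h ⊢
    exact Subtype.ext (PosForm.ext h.1 h.2.1 h.2.2)
  refine Finite.of_surjective (fun Q : R => (⟦Q.1⟧ : FormClass D)) fun h => ?_
  induction h using Quotient.inductionOn with
  | h Q =>
    obtain ⟨Q', hQ', hb, hac⟩ := Q.exists_reduced
    have ha := Q'.a_pos
    have hd := Q'.disc_eq
    have hbb : Q'.b ^ 2 ≤ Q'.a ^ 2 := sq_le_sq' (by linarith [(abs_le.mp hb).1]) (abs_le.mp hb).2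
    have haD : Q'.a ≤ -D := by nlinarith
    have hcD : Q'.c ≤ D ^ 2 - D := by nlinarith
    refine ⟨⟨Q', ⟨ha.le, haD⟩, ⟨?_, ?_⟩, ⟨by linarith, hcD⟩⟩, Quotient.sound hQ'.symm⟩
    · simp only; linarith [(abs_le.mp hb).1]
    · simp only; linarith [(abs_le.mp hb).2]

instance FormClass.fintype (D : ℤ) : Fintype (FormClass D) := Fintype.ofFinite _

/-- The number `r(Q_h, n)` of representations of `n` by any form in the class `h`. -/
def FormClass.rep {D : ℤ} (h : FormClass D) (n : ℕ) : ℕ :=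
  Quotient.lift (fun Q : PosForm D => Q.rep n) (fun _ _ hQ => PosForm.rep_congr hQ n) h

/-- `a(n) = ∑_{h ∈ H(D)} r(Q_h, n)`. -/
def totalRep (D : ℤ) (n : ℕ) : ℕ := ∑ h : FormClass D, h.rep n

/-- The theta series `Θ_h = ∑_{n ≥ 0} r(Q_h, n) qⁿ`. -/
def theta {D : ℤ} (h : FormClass D) : PowerSeries ℤ := PowerSeries.mk fun n => (h.rep n : ℤ)

/-- `∑ c(n) qⁿ ↦ ∑ c(p n) qⁿ`. -/
def opU (p : ℕ) (f : PowerSeries ℤ) : PowerSeries ℤ :=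
  PowerSeries.mk fun n => PowerSeries.coeff (p * n) f

/-- `∑ c(n) qⁿ ↦ ∑ c(n) q^(p n)`. -/
def opV (p : ℕ) (f : PowerSeries ℤ) : PowerSeries ℤ :=
  PowerSeries.mk fun n => if p ∣ n then PowerSeries.coeff (n / p) f else 0

/-- The Hecke operator `T_p = U_p + (D / p) V_p` (weight one, character `(D / ·)`). -/
def opT (D : ℤ) (p : ℕ) (f : PowerSeries ℤ) : PowerSeries ℤ :=
  opU p f + kroneckerSym D p • opV p f

/-- The number of units of the imaginary quadratic order of discriminant `D < 0`. -/
def wNum (D : ℤ) : ℕ := if D = -4 then 4 else if D = -3 then 6 else 2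

/-- The imaginary quadratic field `ℚ(√D)`, for `D < 0`, as a subfield of `ℂ`. -/
abbrev quadField (D : ℤ) : IntermediateField ℚ ℂ :=
  IntermediateField.adjoin ℚ {((√(-(D : ℝ)) : ℝ) : ℂ) * Complex.I}

instance quadField.numberField (D : ℤ) : NumberField (quadField D) where
  to_charZero := inferInstance
  to_finiteDimensional := by
    refine IntermediateField.adjoin.finiteDimensional ?_
    refine IsIntegral.of_pow (n := 2) (by norm_num) ?_
    have h : (((√(-(D : ℝ)) : ℝ) : ℂ) * Complex.I) ^ 2
        = algebraMap ℤ ℂ (-(max (-D) 0)) := by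
      rw [mul_pow, Complex.I_sq, ← Complex.ofReal_pow]
      rcases le_total 0 (-D) with hD | hD
      · rw [max_eq_left hD, Real.sq_sqrt (by exact_mod_cast hD)]; simp
      · rw [max_eq_right hD, Real.sqrt_eq_zero_of_nonpos (by exact_mod_cast hD)]; simp
    rw [h]
    exact (isIntegral_algebraMap (R := ℤ)).tower_top

/-- `Q` is the form `N(α x + β y) / N(I)` attached to the ideal `I` and a `ℤ`-basis `(α, β)` of `I`
that is positively oriented, that is, `Im (β / α) > 0` (equivalently `Im (conj α * β) > 0`). -/
def IsIdealForm {D : ℤ} (I : Ideal (𝓞 (quadField D))) (Q : PosForm D) : Prop :=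
  ∃ v : Module.Basis (Fin 2) ℤ I,
    0 < (((v 1 : 𝓞 (quadField D)) : quadField D) / ((v 0 : 𝓞 (quadField D)) : quadField D) :
      ℂ).im ∧
    ∀ x y : ℤ, Algebra.norm ℤ (x • (v 0 : 𝓞 (quadField D)) + y • (v 1 : 𝓞 (quadField D))) =
      (Ideal.absNorm I : ℤ) * Q.eval x y

end HeckeTheta

end

/-! Representations of `n` by `Q_h` are elements of norm `n N(I)` in an ideal `I` of the class
corresponding to `h`. Concretely, the ring of integers is `ℤ ⊕ ℤω` with `ω² = eω + k`, `e ∈ {0, 1}`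
and `e² + 4k = D`. An oriented basis of `I` gives the form `N(αx + βy)/N(I)`; proper equivalence of
forms matches equality of ideal classes (`exists_classGroup_equiv`).

The Hecke action is then a count. If `z ∈ I` has norm `p n N(I)`, write `(z) = IJ`; then `N(J) =
pn`, so some prime over `p` divides `J` and `z` lies in `IP` for some `P` over `p`
(`exists_isMaximal_mem_mul`). For ramified `p` this identifies the set with the elements of norm `n
N(IP)` in `IP`. For split `p` it is a union of two such sets meeting in `pI`, and
inclusion-exclusion produces the `V_p` term. For inert `p` all of these elements lie in `pI`, and
the two terms of `T_p` cancel. The Kronecker symbol is matched with the splitting type through the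
roots of `X² - eX - k` modulo `p`.

Multiplication by an ideal class permutes `H`, so summing over `h` gives the eigenvalue `1 + (D/p)`.
Gauss's formula follows because `a(n)` and `w ∑_{t ∣ n} (D/t)` satisfy the same recursion and agree
at `n = 1`: only the principal class represents `1`, in `w` ways. -/

set_option linter.unusedSectionVars false

noncomputable section

namespace HeckeTheta

/-- A `ℤ`-basis of the form `(1, ω)` of a ring, where `ω² = e ω + k`. -/
structure QuadBasis (R : Type*) [CommRing R] (e k : ℤ) where
  basis : Module.Basis (Fin 2) ℤ R
  basis_zero : basis 0 = 1
  basis_one_mul_self : basis 1 * basis 1 = (e : R) * basis 1 + (k : R)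

/-! ### Coordinates, norm and area in a ring `ℤ ⊕ ℤω` -/

namespace QuadBasis

section Ring

variable {R : Type*} [CommRing R] {e k : ℤ} (S : QuadBasis R e k)

/-- The element `x + y ω`. -/
def elt (x y : ℤ) : R := x + y * S.basis 1

theorem elt_eq (x y : ℤ) : S.elt x y = x • S.basis 0 + y • S.basis 1 := by
  simp [elt, S.basis_zero]

theorem exists_eq_elt (z : R) : ∃ x y : ℤ, z = S.elt x y := by
  refine ⟨S.basis.repr z 0, S.basis.repr z 1, ?_⟩
  conv_lhs => rw [← S.basis.sum_repr z, Fin.sum_univ_two]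
  rw [elt_eq]

@[simp] theorem repr_elt_zero (x y : ℤ) : S.basis.repr (S.elt x y) 0 = x := by
  rw [elt_eq]; simp [-zsmul_eq_mul]

@[simp] theorem repr_elt_one (x y : ℤ) : S.basis.repr (S.elt x y) 1 = y := by
  rw [elt_eq]; simp [-zsmul_eq_mul]

theorem elt_inj {x y x' y' : ℤ} : S.elt x y = S.elt x' y' ↔ x = x' ∧ y = y' := by
  refine ⟨fun h => ⟨?_, ?_⟩, fun h => by rw [h.1, h.2]⟩
  · rw [← S.repr_elt_zero x y, h, repr_elt_zero]
  · rw [← S.repr_elt_one x y, h, repr_elt_one]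

theorem elt_mul (x y x' y' : ℤ) :
    S.elt x y * S.elt x' y' = S.elt (x * x' + k * y * y') (x * y' + y * x' + e * y * y') := by
  simp only [elt]; push_cast
  linear_combination ((y : R) * y') * S.basis_one_mul_self

theorem elt_add (x y x' y' : ℤ) : S.elt x y + S.elt x' y' = S.elt (x + x') (y + y') := by
  simp only [elt]; push_cast; ring

theorem intCast_eq (n : ℤ) : (n : R) = S.elt n 0 := by simp [elt]

theorem intCast_mul_elt (n x y : ℤ) : (n : R) * S.elt x y = S.elt (n * x) (n * y) := by
  simp only [elt]; push_cast; ring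

theorem elt_zero : S.elt 0 0 = 0 := by simp [elt]

theorem norm_elt (x y : ℤ) : Algebra.norm ℤ (S.elt x y) = x ^ 2 + e * x * y - k * y ^ 2 := by
  have h0 : S.basis 0 = S.elt 1 0 := by simp [elt, S.basis_zero]
  have h1 : S.basis 1 = S.elt 0 1 := by simp [elt]
  rw [Algebra.norm_eq_matrix_det S.basis, Matrix.det_fin_two]
  simp only [Algebra.leftMulMatrix_eq_repr_mul, h0, h1, elt_mul, repr_elt_zero, repr_elt_one]
  ring

theorem norm_intCast (S : QuadBasis R e k) (n : ℤ) : Algebra.norm ℤ (n : R) = n ^ 2 := by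
  rw [S.intCast_eq, norm_elt]; ring

/-- Since the conjugate of `ω` is `e - ω`, the second factor is the conjugate of the first. -/
theorem norm_elt_conj (x y : ℤ) :
    S.elt x y * S.elt (x + e * y) (-y) = (Algebra.norm ℤ (S.elt x y) : ℤ) := by
  rw [elt_mul, norm_elt, S.intCast_eq, elt_inj]
  constructor <;> ring

/-- The determinant of the pair `(α, β)` with respect to the basis `(1, ω)`. -/
def area (α β : R) : ℤ :=
  S.basis.repr α 0 * S.basis.repr β 1 - S.basis.repr α 1 * S.basis.repr β 0

@[simp] theorem area_elt (x y x' y' : ℤ) : S.area (S.elt x y) (S.elt x' y') = x * y' - y * x' := by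
  simp [area]

/-- Multiplication by `γ` is a linear map of determinant `N(γ)`. -/
theorem area_mul_left (γ α β : R) :
    S.area (γ * α) (γ * β) = Algebra.norm ℤ γ * S.area α β := by
  obtain ⟨c, d, rfl⟩ := S.exists_eq_elt γ
  obtain ⟨x, y, rfl⟩ := S.exists_eq_elt α
  obtain ⟨x', y', rfl⟩ := S.exists_eq_elt β
  simp only [elt_mul, area_elt, norm_elt]
  ring

theorem area_comb (α β : R) (p q r s : ℤ) :
    S.area (p * α + q * β) (r * α + s * β) = (p * s - q * r) * S.area α β := by
  obtain ⟨x, y, rfl⟩ := S.exists_eq_elt α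
  obtain ⟨x', y', rfl⟩ := S.exists_eq_elt β
  simp only [intCast_mul_elt, elt_add, area_elt]
  ring

theorem area_swap (α β : R) : S.area β α = - S.area α β := by
  simp only [area]; ring

/-- The polarisation of the norm. -/
theorem exists_polar (α β : R) : ∃ t : ℤ,
    (∀ x y : ℤ, Algebra.norm ℤ ((x : R) * α + (y : R) * β) =
      Algebra.norm ℤ α * x ^ 2 + t * x * y + Algebra.norm ℤ β * y ^ 2) ∧
    t ^ 2 - 4 * Algebra.norm ℤ α * Algebra.norm ℤ β = S.area α β ^ 2 * (e ^ 2 + 4 * k) := by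
  obtain ⟨a, b, rfl⟩ := S.exists_eq_elt α
  obtain ⟨c, d, rfl⟩ := S.exists_eq_elt β
  -- This is the trace of `α` times the conjugate of `β`.
  refine ⟨2 * a * c + e * (a * d + b * c) - 2 * k * b * d, fun x y => ?_, ?_⟩
  · simp only [intCast_mul_elt, elt_add, norm_elt]; ring
  · simp only [norm_elt, area_elt]; ring

theorem norm_pos (S : QuadBasis R e k) (hD : e ^ 2 + 4 * k < 0) {z : R} (hz : z ≠ 0) : 0 < Algebra.norm ℤ z := by
  obtain ⟨x, y, rfl⟩ := S.exists_eq_elt z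
  rw [norm_elt]
  have h4 : 4 * (x ^ 2 + e * x * y - k * y ^ 2) =
      (2 * x + e * y) ^ 2 + (-(e ^ 2 + 4 * k)) * y ^ 2 := by ring
  rcases eq_or_ne y 0 with rfl | hy
  · have hx : x ≠ 0 := by rintro rfl; exact hz S.elt_zero
    have := sq_pos_of_ne_zero hx
    nlinarith
  · have := sq_pos_of_ne_zero hy
    nlinarith [sq_nonneg (2 * x + e * y), mul_pos (neg_pos.mpr hD) this]

theorem det_eq_area (v : Fin 2 → R) : S.basis.det v = S.area (v 0) (v 1) := by
  rw [Module.Basis.det_apply, Matrix.det_fin_two]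
  simp only [Module.Basis.toMatrix_apply, area]
  ring

theorem coords_eq_zero {α β : R} (h : S.area α β ≠ 0) {x y : ℤ}
    (hxy : (x : R) * α + (y : R) * β = 0) : x = 0 ∧ y = 0 := by
  obtain ⟨a, b, rfl⟩ := S.exists_eq_elt α
  obtain ⟨c, d, rfl⟩ := S.exists_eq_elt β
  rw [intCast_mul_elt, intCast_mul_elt, elt_add, ← S.elt_zero, elt_inj] at hxy
  rw [area_elt] at h
  constructor
  · apply (mul_eq_zero.mp (?_ : (a * d - b * c) * x = 0)).resolve_left h
    linear_combination d * hxy.1 - c * hxy.2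
  · apply (mul_eq_zero.mp (?_ : (a * d - b * c) * y = 0)).resolve_left h
    linear_combination a * hxy.2 - b * hxy.1

theorem mem_iff_of_basis {I : Ideal R} (v : Module.Basis (Fin 2) ℤ I) (z : R) :
    z ∈ I ↔ ∃ x y : ℤ, z = x * (v 0 : R) + y * (v 1 : R) := by
  constructor
  · intro hz
    refine ⟨v.repr ⟨z, hz⟩ 0, v.repr ⟨z, hz⟩ 1, ?_⟩
    have := congrArg Subtype.val (v.sum_repr ⟨z, hz⟩)
    rw [Fin.sum_univ_two] at this
    simpa using this.symm
  · rintro ⟨x, y, rfl⟩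
    exact I.add_mem (I.mul_mem_left _ (v 0).2) (I.mul_mem_left _ (v 1).2)

theorem exists_basis {I : Ideal R} {α β : R} (h : S.area α β ≠ 0)
    (hI : ∀ z, z ∈ I ↔ ∃ x y : ℤ, z = x * α + y * β) :
    ∃ v : Module.Basis (Fin 2) ℤ I, (v 0 : R) = α ∧ (v 1 : R) = β := by
  have hα : α ∈ I := (hI _).mpr ⟨1, 0, by simp⟩
  have hβ : β ∈ I := (hI _).mpr ⟨0, 1, by simp⟩
  refine ⟨Module.Basis.mk (v := ![(⟨α, hα⟩ : I), ⟨β, hβ⟩]) ?_ ?_, ?_, ?_⟩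
  · rw [LinearIndependent.pair_iff]
    intro x y hxy
    apply S.coords_eq_zero h
    simpa using congrArg Subtype.val hxy
  · rintro ⟨z, hz⟩ -
    obtain ⟨x, y, rfl⟩ := (hI _).mp hz
    have : (⟨(x : R) * α + y * β, hz⟩ : I) = x • ⟨α, hα⟩ + y • ⟨β, hβ⟩ := by
      apply Subtype.ext; simp
    rw [this]
    exact Submodule.add_mem _ (Submodule.smul_mem _ _ (Submodule.subset_span ⟨0, rfl⟩))
      (Submodule.smul_mem _ _ (Submodule.subset_span ⟨1, rfl⟩))
  · simp
  · simp

end Ring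

/-! ### Ideal classes and classes of forms -/

section Dedekind

variable {R : Type*} [CommRing R] [IsDedekindDomain R] [CharZero R] [Module.Free ℤ R]
  [Module.Finite ℤ R] {e k : ℤ} (S : QuadBasis R e k) {D : ℤ}

theorem absNorm_eq_natAbs_area {I : Ideal R} {α β : R} (h : S.area α β ≠ 0)
    (hI : ∀ z, z ∈ I ↔ ∃ x y : ℤ, z = x * α + y * β) :
    Ideal.absNorm I = (S.area α β).natAbs := by
  obtain ⟨v, rfl, rfl⟩ := S.exists_basis h hI
  rw [← Ideal.natAbs_det_basis_change S.basis I v, det_eq_area]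
  rfl

/-- `Q` is the norm form of the ideal `I` with respect to some positively oriented basis. -/
def IsNormForm (I : Ideal R) (Q : PosForm D) : Prop :=
  ∃ α β : R, 0 < S.area α β ∧ (∀ z, z ∈ I ↔ ∃ x y : ℤ, z = x * α + y * β) ∧
    ∀ x y : ℤ, Algebra.norm ℤ ((x : R) * α + (y : R) * β) = (Ideal.absNorm I : ℤ) * Q.eval x y

variable {S}

/-- The substitution is absorbed by changing the basis with the transposed matrix, which keeps the
area because the determinant is `1`. -/
theorem IsNormForm.of_equivalent {I : Ideal R} {Q Q' : PosForm D} (h : S.IsNormForm I Q)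
    (hQ : Q ≈ Q') : S.IsNormForm I Q' := by
  obtain ⟨α, β, hpos, hI, hN⟩ := h
  obtain ⟨g, hg⟩ := hQ
  have hd := PosForm.det_eq g
  refine ⟨g.1 0 0 * α + g.1 1 0 * β, g.1 0 1 * α + g.1 1 1 * β, ?_, fun z => ?_, fun x y => ?_⟩
  · rw [area_comb, mul_comm (g.1 1 0), hd, one_mul]; exact hpos
  · rw [hI]
    constructor
    · rintro ⟨x, y, rfl⟩
      refine ⟨g.1 1 1 * x - g.1 0 1 * y, -g.1 1 0 * x + g.1 0 0 * y, ?_⟩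
      have hd' : (g.1 0 0 * g.1 1 1 - g.1 0 1 * g.1 1 0 : R) = 1 := by exact_mod_cast hd
      push_cast
      linear_combination (-(x * α) - y * β) * hd'
    · rintro ⟨x, y, rfl⟩
      refine ⟨g.1 0 0 * x + g.1 0 1 * y, g.1 1 0 * x + g.1 1 1 * y, ?_⟩
      push_cast; ring
  · rw [hg, ← hN]
    congr 1
    push_cast; ring

/-- Two positively oriented bases of `I` both have area `N(I)`, so the change of basis has
determinant `+1`. -/
theorem IsNormForm.equivalent {I : Ideal R} {Q Q' : PosForm D} (h : S.IsNormForm I Q)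
    (h' : S.IsNormForm I Q') : Q ≈ Q' := by
  obtain ⟨α, β, hpos, hI, hN⟩ := h
  obtain ⟨α', β', hpos', hI', hN'⟩ := h'
  have hA := S.absNorm_eq_natAbs_area hpos.ne' hI
  have hA' := S.absNorm_eq_natAbs_area hpos'.ne' hI'
  obtain ⟨p, q, hα⟩ := (hI α').mp ((hI' _).mpr ⟨1, 0, by simp⟩)
  obtain ⟨r, s, hβ⟩ := (hI β').mp ((hI' _).mpr ⟨0, 1, by simp⟩)
  have hareas : S.area α' β' = S.area α β := by omega
  have hd : p * s - q * r = 1 := by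
    rw [hα, hβ, area_comb] at hareas
    exact mul_right_cancel₀ hpos.ne' (by rw [hareas, one_mul])
  refine ⟨⟨!![p, r; q, s], by rw [Matrix.det_fin_two_of]; linarith⟩, fun x y => ?_⟩
  have hI0 : (Ideal.absNorm I : ℤ) ≠ 0 := by omega
  apply mul_left_cancel₀ hI0
  rw [← hN', ← hN, hα, hβ]
  congr 1
  simp
  ring

/-- In the imaginary case `N(γ) > 0`, so multiplication by `γ` keeps the orientation and scales
norms of elements and of the ideal alike. -/
theorem IsNormForm.span_mul (hD : e ^ 2 + 4 * k < 0) {I : Ideal R} {Q : PosForm D}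
    (h : S.IsNormForm I Q) {γ : R} (hγ : γ ≠ 0) : S.IsNormForm (Ideal.span {γ} * I) Q := by
  obtain ⟨α, β, hpos, hI, hN⟩ := h
  have hγN := S.norm_pos hD hγ
  refine ⟨γ * α, γ * β, ?_, fun z => ?_, fun x y => ?_⟩
  · rw [area_mul_left]; positivity
  · rw [Ideal.mem_span_singleton_mul]
    constructor
    · rintro ⟨i, hi, rfl⟩
      obtain ⟨x, y, rfl⟩ := (hI i).mp hi
      exact ⟨x, y, by ring⟩
    · rintro ⟨x, y, rfl⟩
      exact ⟨_, (hI _).mpr ⟨x, y, rfl⟩, by ring⟩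
  · rw [show (x : R) * (γ * α) + y * (γ * β) = γ * (x * α + y * β) by ring, map_mul, hN, map_mul,
      Ideal.absNorm_span_singleton]
    push_cast
    rw [abs_of_pos hγN]; ring

theorem IsNormForm.polar {I : Ideal R} {Q : PosForm D} {α β : R}
    (hN : ∀ x y : ℤ, Algebra.norm ℤ ((x : R) * α + (y : R) * β) =
      (Ideal.absNorm I : ℤ) * Q.eval x y) :
    Algebra.norm ℤ α = Ideal.absNorm I * Q.a ∧ Algebra.norm ℤ β = Ideal.absNorm I * Q.c ∧
      ∀ a b c d : ℤ, α = S.elt a b → β = S.elt c d →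
        2 * a * c + e * (a * d + b * c) - 2 * k * b * d = Ideal.absNorm I * Q.b := by
  have h1 := hN 1 0
  have h2 := hN 0 1
  have h3 := hN 1 1
  simp only [PosForm.eval] at h1 h2 h3
  simp at h1 h2 h3
  refine ⟨h1, h2, ?_⟩
  rintro a b c d rfl rfl
  rw [elt_add, norm_elt] at h3
  rw [norm_elt] at h1 h2
  linear_combination h3 - h1 - h2

/-- The form and the orientation determine the ratio `β/α`, so `β/α = δ/γ`; this is `key`, and it
makes `γI = αJ`. -/
theorem IsNormForm.exists_span_mul_eq {I J : Ideal R} {Q : PosForm D}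
    (h : S.IsNormForm I Q) (h' : S.IsNormForm J Q) :
    ∃ x y : R, x ≠ 0 ∧ y ≠ 0 ∧ Ideal.span {x} * I = Ideal.span {y} * J := by
  obtain ⟨α, β, hpos, hI, hN⟩ := h
  obtain ⟨γ, δ, hpos', hJ, hN'⟩ := h'
  have hA := S.absNorm_eq_natAbs_area hpos.ne' hI
  have hA' := S.absNorm_eq_natAbs_area hpos'.ne' hJ
  have hA : (Ideal.absNorm I : ℤ) = S.area α β := by omega
  have hA' : (Ideal.absNorm J : ℤ) = S.area γ δ := by omega
  obtain ⟨n1, -, t1⟩ := IsNormForm.polar (S := S) hN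
  obtain ⟨n2, -, t2⟩ := IsNormForm.polar (S := S) hN'
  have hα : α ≠ 0 := by rintro rfl; simp [area] at hpos
  have hγ : γ ≠ 0 := by rintro rfl; simp [area] at hpos'
  have key : γ * β = α * δ := by
    obtain ⟨a, b, rfl⟩ := S.exists_eq_elt α
    obtain ⟨c, d, rfl⟩ := S.exists_eq_elt β
    obtain ⟨a', b', rfl⟩ := S.exists_eq_elt γ
    obtain ⟨c', d', rfl⟩ := S.exists_eq_elt δ
    have s1 := t1 _ _ _ _ rfl rfl
    have s2 := t2 _ _ _ _ rfl rfl
    have c1 := S.norm_elt_conj a b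
    have c2 := S.norm_elt_conj a' b'
    set A : ℤ := ((Ideal.absNorm I : ℕ) : ℤ)
    set A' : ℤ := ((Ideal.absNorm J : ℕ) : ℤ)
    rw [area_elt] at hA hA'
    -- After division by the ideal norms, `β` times the conjugate of `α` agrees with `δ` times the
    -- conjugate of `γ`: the `ω`-coordinate is the area and the trace is the middle coefficient.
    have hc : (A' : R) * (S.elt c d * S.elt (a + e * b) (-b)) =
        A * (S.elt c' d' * S.elt (a' + e * b') (-b')) := by
      rw [elt_mul, elt_mul, intCast_mul_elt, intCast_mul_elt, elt_inj]
      constructor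
      · apply mul_left_cancel₀ (two_ne_zero (α := ℤ))
        linear_combination A' * s1 - A * s2 - e * A * hA' + e * A' * hA
      · linear_combination A * hA' - A' * hA
    -- Multiplying `hc` by `αγ` turns the conjugates into `N(α) = A a` and `N(γ) = A' a`, which
    -- leaves this common factor to cancel.
    have hAne : ((A * A' * Q.a : ℤ) : R) ≠ 0 := by
      rw [Int.cast_ne_zero]
      have := Q.a_pos
      rw [area_elt, ← hA] at hpos
      rw [area_elt, ← hA'] at hpos'
      positivity
    apply mul_left_cancel₀ hAne
    rw [n1] at c1
    rw [n2] at c2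
    push_cast at c1 c2 ⊢
    linear_combination S.elt a b * S.elt a' b' * hc - A' * S.elt a' b' * S.elt c d * c1
      + A * S.elt a b * S.elt c' d' * c2
  refine ⟨γ, α, hγ, hα, ?_⟩
  ext z
  rw [Ideal.mem_span_singleton_mul, Ideal.mem_span_singleton_mul]
  constructor
  · rintro ⟨i, hi, rfl⟩
    obtain ⟨x, y, rfl⟩ := (hI i).mp hi
    exact ⟨_, (hJ _).mpr ⟨x, y, rfl⟩, by linear_combination (-y : R) * key⟩
  · rintro ⟨i, hi, rfl⟩
    obtain ⟨x, y, rfl⟩ := (hJ i).mp hi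
    exact ⟨_, (hI _).mpr ⟨x, y, rfl⟩, by linear_combination (y : R) * key⟩

theorem IsNormForm.ne_bot {I : Ideal R} {Q : PosForm D} (h : S.IsNormForm I Q) : I ≠ ⊥ := by
  obtain ⟨α, β, hpos, hI, hN⟩ := h
  have hA := S.absNorm_eq_natAbs_area hpos.ne' hI
  intro h0
  rw [h0, Ideal.absNorm_bot] at hA
  omega

variable (S)

/-- `N(I)` divides the norm of every element of `I`, so the quotient form is integral. Its
discriminant is `area² D / N(I)² = D`. -/
theorem exists_isNormForm (hD : e ^ 2 + 4 * k = D) (hneg : D < 0) {I : Ideal R} (hI : I ≠ ⊥) :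
    ∃ Q : PosForm D, S.IsNormForm I Q := by
  obtain ⟨α, β, hpos, hI'⟩ : ∃ α β : R, 0 < S.area α β ∧
      ∀ z, z ∈ I ↔ ∃ x y : ℤ, z = x * α + y * β := by
    have hmem := mem_iff_of_basis (I.selfBasis S.basis hI)
    set v := I.selfBasis S.basis hI
    have h0 : S.area (v 0) (v 1) ≠ 0 := by
      have := Ideal.natAbs_det_basis_change S.basis I v
      rw [det_eq_area] at this
      intro h
      simp only [Function.comp, h, Int.natAbs_zero] at this
      exact hI (Ideal.absNorm_eq_zero_iff.mp this.symm)
    rcases h0.lt_or_gt with h0 | h0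
    · refine ⟨v 1, v 0, by rw [area_swap]; omega, fun z => (hmem z).trans ?_⟩
      exact ⟨fun ⟨x, y, h⟩ => ⟨y, x, by rw [h, add_comm]⟩,
        fun ⟨x, y, h⟩ => ⟨y, x, by rw [h, add_comm]⟩⟩
    · exact ⟨v 0, v 1, h0, hmem⟩
  have hA := S.absNorm_eq_natAbs_area hpos.ne' hI'
  have hA : S.area α β = Ideal.absNorm I := by omega
  have hApos : 0 < (Ideal.absNorm I : ℤ) := hA ▸ hpos
  obtain ⟨t, ht, hdisc⟩ := S.exists_polar α β
  have hdvd : ∀ x y : ℤ, (Ideal.absNorm I : ℤ) ∣ Algebra.norm ℤ ((x : R) * α + (y : R) * β) :=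
    fun x y => Ideal.absNorm_dvd_norm_of_mem ((hI' _).mpr ⟨x, y, rfl⟩)
  obtain ⟨a, ha⟩ := hdvd 1 0
  obtain ⟨c, hc⟩ := hdvd 0 1
  -- Here `b` is the value at `(1, 1)`; the middle coefficient is therefore `b - a - c`.
  obtain ⟨b, hb⟩ := hdvd 1 1
  simp only [Int.cast_one, Int.cast_zero, one_mul, zero_mul, add_zero, zero_add] at ha hc
  rw [ht] at hb
  have hb : t = Ideal.absNorm I * (b - a - c) := by linear_combination hb - ha - hc
  have hN : ∀ x y : ℤ, Algebra.norm ℤ ((x : R) * α + (y : R) * β) =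
      (Ideal.absNorm I : ℤ) * (a * x ^ 2 + (b - a - c) * x * y + c * y ^ 2) := by
    intro x y
    rw [ht, ha, hc, hb]; ring
  refine ⟨⟨a, b - a - c, c, ?_, fun x y hxy => ?_⟩, α, β, hpos, hI', hN⟩
  · rw [ha, hc, hb, hA, hD] at hdisc
    apply mul_left_cancel₀ (pow_ne_zero 2 hApos.ne')
    linear_combination hdisc
  · have hz : (x : R) * α + y * β ≠ 0 := by
      intro h
      apply hxy
      obtain ⟨rfl, rfl⟩ := S.coords_eq_zero hpos.ne' h
      rfl
    have := S.norm_pos (by omega) hz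
    rw [hN] at this
    exact pos_of_mul_pos_right this hApos.le

/-- For `Q = [a, b, c]` with `b = 2t + e`, the ideal is `ℤa + ℤ(t + ω)`. Its norm is `a`, and `N(t +
ω) = ac`. -/
theorem exists_ideal_isNormForm (hD : e ^ 2 + 4 * k = D) (Q : PosForm D) :
    ∃ I : Ideal R, S.IsNormForm I Q := by
  have hd := Q.disc_eq
  obtain ⟨t, ht⟩ : ∃ t, Q.b = 2 * t + e := by
    have h : (Q.b - e) % 2 = 0 := by
      have h2 : Even (Q.b ^ 2 - e ^ 2) := ⟨2 * (Q.a * Q.c + k), by linarith⟩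
      rw [Int.even_sub, Int.even_pow' two_ne_zero, Int.even_pow' two_ne_zero, ← Int.even_sub] at h2
      exact Int.even_iff.mp h2
    exact ⟨(Q.b - e) / 2, by omega⟩
  have hac : Q.a * Q.c = t ^ 2 + e * t - k := by
    apply mul_left_cancel₀ (four_ne_zero (α := ℤ))
    rw [ht] at hd
    linear_combination -hd + hD
  let I : Ideal R :=
    { carrier := {z | ∃ x y : ℤ, z = x * S.elt Q.a 0 + y * S.elt t 1}
      add_mem' := by
        rintro _ _ ⟨x, y, rfl⟩ ⟨x', y', rfl⟩
        exact ⟨x + x', y + y', by push_cast; ring⟩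
      zero_mem' := ⟨0, 0, by simp⟩
      smul_mem' := by
        rintro c _ ⟨x, y, rfl⟩
        obtain ⟨u, w, rfl⟩ := S.exists_eq_elt c
        -- From `ω·a = -t·a + a(t + ω)` and `ω(t + ω) = -c·a + (t + e)(t + ω)`.
        refine ⟨u * x - w * t * x - w * y * Q.c, u * y + w * Q.a * x + w * y * (t + e), ?_⟩
        simp only [smul_eq_mul, intCast_mul_elt, elt_add, elt_mul, elt_inj]
        constructor
        · linear_combination (w * y) * hac
        · ring }
  have hpos : 0 < S.area (S.elt Q.a 0) (S.elt t 1) := by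
    rw [area_elt]; linarith [Q.a_pos]
  have hI : ∀ z, z ∈ I ↔ ∃ x y : ℤ, z = x * S.elt Q.a 0 + y * S.elt t 1 := fun z => Iff.rfl
  refine ⟨I, S.elt Q.a 0, S.elt t 1, hpos, hI, fun x y => ?_⟩
  have hA := S.absNorm_eq_natAbs_area hpos.ne' hI
  have hA : (Ideal.absNorm I : ℤ) = Q.a := by
    rw [area_elt] at hA hpos
    omega
  rw [hA, intCast_mul_elt, intCast_mul_elt, elt_add, norm_elt, PosForm.eval, ht]
  linear_combination -y ^ 2 * hac

/-- The bijection between ideal classes and classes of forms. -/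
theorem exists_classGroup_equiv (hD : e ^ 2 + 4 * k = D) (hneg : D < 0) :
    ∃ f : ClassGroup R ≃ FormClass D, ∀ (I : (Ideal R)⁰) (Q : PosForm D),
      f (ClassGroup.mk0 I) = ⟦Q⟧ ↔ S.IsNormForm (I : Ideal R) Q := by
  have hex : ∀ c : ClassGroup R, ∃ I : (Ideal R)⁰, ∃ Q : PosForm D,
      ClassGroup.mk0 I = c ∧ S.IsNormForm (I : Ideal R) Q := by
    intro c
    obtain ⟨I, rfl⟩ := ClassGroup.mk0_surjective c
    obtain ⟨Q, hQ⟩ := S.exists_isNormForm hD hneg (nonZeroDivisors.ne_zero I.2)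
    exact ⟨I, Q, rfl, hQ⟩
  -- This makes the map on classes both well defined and injective.
  have hcong : ∀ (I J : (Ideal R)⁰) (Q Q' : PosForm D), S.IsNormForm (I : Ideal R) Q →
      S.IsNormForm (J : Ideal R) Q' → (ClassGroup.mk0 I = ClassGroup.mk0 J ↔ Q ≈ Q') := by
    intro I J Q Q' hI hJ
    rw [ClassGroup.mk0_eq_mk0_iff]
    constructor
    · rintro ⟨x, y, hx, hy, hxy⟩
      have h1 := hI.span_mul (by omega) hx
      rw [hxy] at h1
      exact h1.equivalent (hJ.span_mul (by omega) hy)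
    · intro hQ
      obtain ⟨x, y, hx, hy, hxy⟩ := (hI.of_equivalent hQ).exists_span_mul_eq hJ
      exact ⟨x, y, hx, hy, hxy⟩
  choose I Q hIc hIQ using hex
  have hbij : Function.Bijective (fun c => (⟦Q c⟧ : FormClass D)) := by
    constructor
    · intro c c' h
      rw [← hIc c, ← hIc c', hcong _ _ _ _ (hIQ c) (hIQ c')]
      exact Quotient.exact h
    · intro h
      induction h using Quotient.inductionOn with
      | h Q₀ =>
        obtain ⟨J, hJ⟩ := S.exists_ideal_isNormForm hD Q₀
        let J' : (Ideal R)⁰ := ⟨J, mem_nonZeroDivisors_of_ne_zero hJ.ne_bot⟩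
        refine ⟨ClassGroup.mk0 J', Quotient.sound ?_⟩
        exact (hcong (I (ClassGroup.mk0 J')) J' _ _ (hIQ _) hJ).mp (hIc _)
  refine ⟨Equiv.ofBijective _ hbij, fun J Q₀ => ?_⟩
  rw [Equiv.ofBijective_apply]
  constructor
  · intro h
    obtain ⟨Q', hQ'⟩ := S.exists_isNormForm hD hneg (nonZeroDivisors.ne_zero J.2)
    have h1 := (hcong _ _ _ _ (hIQ (ClassGroup.mk0 J)) hQ').mp (hIc _)
    exact hQ'.of_equivalent ((Setoid.symm h1).trans (Quotient.exact h))
  · intro h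
    exact Quotient.sound ((hcong _ _ _ _ (hIQ _) h).mp (hIc _))

end Dedekind

/-! ### Elements of norm `p n N(I)`, by factorization of `p` -/

section Counting

variable {R : Type*} [CommRing R] [IsDedekindDomain R] [CharZero R] [Module.Free ℤ R]
  [Module.Finite ℤ R] {e k : ℤ} {S : QuadBasis R e k} {D : ℤ}

/-- The elements of norm `n N(I)` of the ideal `I`. -/
def normSet (I : Ideal R) (n : ℕ) : Set R :=
  {z | z ∈ I ∧ Algebra.norm ℤ z = (Ideal.absNorm I : ℤ) * n}

theorem mem_normSet {I : Ideal R} {n : ℕ} {z : R} :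
    z ∈ normSet I n ↔ z ∈ I ∧ Algebra.norm ℤ z = (Ideal.absNorm I : ℤ) * n := Iff.rfl

theorem IsNormForm.exists_equiv {I : Ideal R} {Q : PosForm D} (h : S.IsNormForm I Q) (n : ℕ) :
    Nonempty ({v : ℤ × ℤ // Q.eval v.1 v.2 = n} ≃ normSet I n) := by
  have hbot := h.ne_bot
  obtain ⟨α, β, hpos, hI, hN⟩ := h
  have hA : (Ideal.absNorm I : ℤ) ≠ 0 := by
    rw [Ne, Nat.cast_eq_zero, Ideal.absNorm_eq_zero_iff]; exact hbot
  refine ⟨Equiv.ofBijective (fun v => ⟨(v.1.1 : R) * α + (v.1.2 : R) * β,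
    mem_normSet.mpr ⟨(hI _).mpr ⟨_, _, rfl⟩, by rw [hN, v.2]⟩⟩) ⟨?_, ?_⟩⟩
  · rintro ⟨⟨x, y⟩, hv⟩ ⟨⟨x', y'⟩, hv'⟩ h
    have h := congrArg Subtype.val h
    have := S.coords_eq_zero hpos.ne' (x := x - x') (y := y - y')
      (by push_cast; linear_combination h)
    simp only [Subtype.mk.injEq, Prod.mk.injEq]
    omega
  · rintro ⟨z, hz, hzn⟩
    obtain ⟨x, y, rfl⟩ := (hI z).mp hz
    exact ⟨⟨(x, y), mul_left_cancel₀ hA ((hN x y).symm.trans hzn)⟩, rfl⟩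

theorem IsNormForm.rep_eq {I : Ideal R} {Q : PosForm D} (h : S.IsNormForm I Q) (n : ℕ) :
    Q.rep n = (normSet I n).ncard := by
  obtain ⟨f⟩ := h.exists_equiv n
  exact Nat.card_congr f

theorem IsNormForm.finite_normSet {I : Ideal R} {Q : PosForm D} (h : S.IsNormForm I Q) (n : ℕ) :
    (normSet I n).Finite := by
  obtain ⟨f⟩ := h.exists_equiv n
  have := Q.finite_rep n
  exact Finite.of_equiv _ f

/-- Write `(z) = IJ`; then `N(J) = pn`, so a prime over `p` divides `J`. -/
theorem exists_isMaximal_mem_mul {I : Ideal R} (hI : I ≠ ⊥) {p : ℕ} (hp : p.Prime) {n : ℕ} {z : R}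
    (hz : z ∈ normSet I (p * n)) :
    ∃ M : Ideal R, M.IsMaximal ∧ (p : R) ∈ M ∧ z ∈ I * M := by
  obtain ⟨hzI, hzn⟩ := hz
  obtain ⟨J, hJ⟩ := Ideal.dvd_span_singleton.mpr hzI
  have hA : Ideal.absNorm I ≠ 0 := by rwa [Ne, Ideal.absNorm_eq_zero_iff]
  have hJn : Ideal.absNorm J = p * n := by
    have := congrArg Ideal.absNorm hJ
    rw [Ideal.absNorm_span_singleton, hzn, map_mul, ← Nat.cast_mul, Int.natAbs_natCast] at this
    exact (Nat.eq_of_mul_eq_mul_left (Nat.pos_of_ne_zero hA) this).symm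
  obtain ⟨M, hM, hMp, hMJ⟩ := Ideal.exists_isMaximal_dvd_of_dvd_absNorm' hp J (hJn ▸ dvd_mul_right _ _)
  refine ⟨M, hM, ?_, ?_⟩
  · have : (p : ℤ) ∈ M.under ℤ := by rw [hMp]; exact Ideal.mem_span_singleton_self _
    simpa [Ideal.mem_comap] using this
  · rw [← Ideal.dvd_span_singleton, hJ]
    exact mul_dvd_mul_left I hMJ

theorem absNorm_span_prime (S : QuadBasis R e k) (p : ℕ) : Ideal.absNorm (Ideal.span {(p : R)}) = p ^ 2 := by
  have := S.norm_intCast p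
  rw [Int.cast_natCast] at this
  rw [Ideal.absNorm_span_singleton, this, Int.natAbs_pow, Int.natAbs_natCast]

theorem absNorm_eq_of_span_eq_mul (S : QuadBasis R e k) {p : ℕ} (hp : p.Prime) {P P' : Ideal R} (hP : P ≠ ⊤)
    (hP' : P' ≠ ⊤) (h : Ideal.span {(p : R)} = P * P') :
    Ideal.absNorm P = p ∧ Ideal.absNorm P' = p := by
  rw [← Nat.Prime.mul_eq_prime_sq_iff hp, ← map_mul, ← h, S.absNorm_span_prime]
  · rwa [Ne, Ideal.absNorm_eq_one_iff]
  · rwa [Ne, Ideal.absNorm_eq_one_iff]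

/-- The elements of norm `p n N(I)` of the ideal `p I`. -/
theorem ncard_span_mul (S : QuadBasis R e k) {I : Ideal R} (hI : I ≠ ⊥) {p : ℕ} (hp : p.Prime) (n : ℕ) :
    {z | z ∈ I * Ideal.span {(p : R)} ∧
      Algebra.norm ℤ z = (Ideal.absNorm I : ℤ) * (p * n : ℕ)}.ncard =
      if p ∣ n then (normSet I (n / p)).ncard else 0 := by
  have hA : (Ideal.absNorm I : ℤ) ≠ 0 := by rwa [Ne, Nat.cast_eq_zero, Ideal.absNorm_eq_zero_iff]
  have hp0 : (p : ℤ) ≠ 0 := by exact_mod_cast hp.ne_zero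
  have hpR : (p : R) ≠ 0 := by exact_mod_cast hp.ne_zero
  have hnorm : ∀ z : R, Algebra.norm ℤ ((p : R) * z) = p ^ 2 * Algebra.norm ℤ z := by
    intro z
    have := S.norm_intCast p
    rw [Int.cast_natCast] at this
    rw [map_mul, this]
  split_ifs with h
  · obtain ⟨m, rfl⟩ := h
    rw [Nat.mul_div_cancel_left _ hp.pos, ← Set.ncard_image_of_injective (normSet I m)
      (mul_right_injective₀ hpR)]
    congr 1
    ext z
    simp only [Set.mem_ofPred_eq, Set.mem_image, mem_normSet, mul_comm I,
      Ideal.mem_span_singleton_mul]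
    constructor
    · rintro ⟨⟨i, hi, rfl⟩, hz⟩
      refine ⟨i, ⟨hi, mul_left_cancel₀ (pow_ne_zero 2 hp0) ?_⟩, rfl⟩
      rw [hnorm] at hz
      rw [hz]; push_cast; ring
    · rintro ⟨i, ⟨hi, hin⟩, rfl⟩
      refine ⟨⟨i, hi, rfl⟩, ?_⟩
      rw [hnorm, hin]; push_cast; ring
  · rw [Set.ncard_eq_zero (hs := ?_)]
    all_goals
      have hemp : {z | z ∈ I * Ideal.span {(p : R)} ∧
        Algebra.norm ℤ z = (Ideal.absNorm I : ℤ) * (p * n : ℕ)} = ∅ := by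
        rw [Set.eq_empty_iff_forall_notMem]
        rintro z ⟨hz, hzn⟩
        rw [mul_comm, Ideal.mem_span_singleton_mul] at hz
        obtain ⟨i, hi, rfl⟩ := hz
        -- For `z = p i`, comparing `p² N(i) = p n N(I)` with `N(I) ∣ N(i)` forces `p ∣ n`.
        obtain ⟨m, hm⟩ := Ideal.absNorm_dvd_norm_of_mem hi
        rw [hnorm, hm] at hzn
        apply h
        rw [← Int.natCast_dvd_natCast]
        refine ⟨m, mul_left_cancel₀ (mul_ne_zero hA hp0) ?_⟩
        push_cast at hzn
        linear_combination -hzn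
    · exact hemp
    · rw [hemp]; exact Set.finite_empty

theorem normSet_mul_eq {I P : Ideal R} {p : ℕ} (hP : Ideal.absNorm P = p) (n : ℕ) :
    normSet (I * P) n =
      {z | z ∈ I * P ∧ Algebra.norm ℤ z = (Ideal.absNorm I : ℤ) * (p * n : ℕ)} := by
  ext z
  simp only [normSet, Set.mem_ofPred_eq, map_mul, hP]
  push_cast
  rw [mul_assoc]

theorem normSet_mul_subset {I P : Ideal R} {p : ℕ} (hP : Ideal.absNorm P = p) (n : ℕ) :
    normSet (I * P) n ⊆ normSet I (p * n) := by
  intro z hz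
  rw [normSet_mul_eq hP, Set.mem_ofPred_eq] at hz
  exact mem_normSet.mpr ⟨Ideal.mul_le_left hz.1, hz.2⟩

theorem ncard_normSet_inert (S : QuadBasis R e k) {I : Ideal R} (hI : I ≠ ⊥) {p : ℕ} (hp : p.Prime)
    (h : (Ideal.span {(p : R)}).IsPrime) (n : ℕ) :
    (normSet I (p * n)).ncard = if p ∣ n then (normSet I (n / p)).ncard else 0 := by
  rw [← S.ncard_span_mul hI hp]
  congr 1
  ext z
  refine ⟨fun hz => ⟨?_, hz.2⟩, fun hz => ⟨Ideal.mul_le_left hz.1, hz.2⟩⟩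
  obtain ⟨M, hM, hpM, hzM⟩ := exists_isMaximal_mem_mul hI hp hz
  have hpR : (p : R) ≠ 0 := by exact_mod_cast hp.ne_zero
  have hmax := h.isMaximal (by simpa using hpR)
  rwa [hmax.eq_of_le hM.ne_top ((Ideal.span_singleton_le_iff_mem _).mpr hpM)]

theorem ncard_normSet_ramified (S : QuadBasis R e k) {I : Ideal R} (hI : I ≠ ⊥) {p : ℕ} (hp : p.Prime) {P : Ideal R}
    (hP : P.IsPrime) (h : Ideal.span {(p : R)} = P ^ 2) (n : ℕ) :
    (normSet I (p * n)).ncard = (normSet (I * P) n).ncard := by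
  rw [pow_two] at h
  have hPn := (S.absNorm_eq_of_span_eq_mul hp hP.ne_top hP.ne_top h).1
  congr 1
  refine Set.Subset.antisymm (fun z hz => ?_) (normSet_mul_subset hPn n)
  obtain ⟨M, hM, hpM, hzM⟩ := exists_isMaximal_mem_mul hI hp hz
  have hP0 : P ≠ ⊥ := by
    rintro rfl
    rw [Ideal.absNorm_bot] at hPn
    exact hp.ne_zero hPn.symm
  have hPM : P ≤ M := by
    have : P * P ≤ M := by rw [← h]; exact (Ideal.span_singleton_le_iff_mem _).mpr hpM
    exact (hM.isPrime.mul_le.mp this).elim id id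
  rw [normSet_mul_eq hPn]
  refine ⟨?_, hz.2⟩
  rwa [(hP.isMaximal hP0).eq_of_le hM.ne_top hPM]

/-- Inclusion-exclusion: every such `z` lies in `IP` or `IP'`, and `IP ∩ IP' = pI` because `P` and
`P'` are coprime. -/
theorem ncard_normSet_split (S : QuadBasis R e k) {I : Ideal R} (hI : I ≠ ⊥) {p : ℕ} (hp : p.Prime) {P P' : Ideal R}
    (hP : P.IsPrime) (hP' : P'.IsPrime) (hne : P ≠ P') (h : Ideal.span {(p : R)} = P * P')
    (n : ℕ) (hfin : (normSet I (p * n)).Finite) :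
    (normSet I (p * n)).ncard + (if p ∣ n then (normSet I (n / p)).ncard else 0) =
      (normSet (I * P) n).ncard + (normSet (I * P') n).ncard := by
  obtain ⟨hPn, hPn'⟩ := S.absNorm_eq_of_span_eq_mul hp hP.ne_top hP'.ne_top h
  have hP0 : P ≠ ⊥ := by
    rintro rfl
    rw [Ideal.absNorm_bot] at hPn
    exact hp.ne_zero hPn.symm
  have hP0' : P' ≠ ⊥ := by
    rintro rfl
    rw [Ideal.absNorm_bot] at hPn'
    exact hp.ne_zero hPn'.symm
  have hmax := hP.isMaximal hP0
  have hmax' := hP'.isMaximal hP0'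
  rw [← Set.ncard_union_add_ncard_inter _ _ (hfin.subset (normSet_mul_subset hPn n))
    (hfin.subset (normSet_mul_subset hPn' n)), ← S.ncard_span_mul hI hp]
  congr 2
  · refine Set.Subset.antisymm (fun z hz => ?_)
      (Set.union_subset (normSet_mul_subset hPn n) (normSet_mul_subset hPn' n))
    obtain ⟨M, hM, hpM, hzM⟩ := exists_isMaximal_mem_mul hI hp hz
    have hPM : P ≤ M ∨ P' ≤ M := by
      have : P * P' ≤ M := by rw [← h]; exact (Ideal.span_singleton_le_iff_mem _).mpr hpM
      exact hM.isPrime.mul_le.mp this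
    rw [normSet_mul_eq hPn, normSet_mul_eq hPn']
    rcases hPM with hPM | hPM
    · exact Or.inl ⟨by rwa [hmax.eq_of_le hM.ne_top hPM], hz.2⟩
    · exact Or.inr ⟨by rwa [hmax'.eq_of_le hM.ne_top hPM], hz.2⟩
  · rw [normSet_mul_eq hPn, normSet_mul_eq hPn', h]
    have hinf : I * P ⊓ I * P' = I * (P * P') := by
      apply le_antisymm
      · have htop : P ⊔ P' = ⊤ := Ideal.IsMaximal.coprime_of_ne hmax hmax' hne
        calc I * P ⊓ I * P' = (I * P ⊓ I * P') * (P ⊔ P') := by rw [htop, Ideal.mul_top]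
          _ ≤ I * (P * P') := by
            rw [Ideal.mul_sup]
            refine sup_le ?_ ?_
            · calc _ ≤ I * P' * P := Ideal.mul_mono_left inf_le_right
                _ = _ := by ring
            · calc _ ≤ I * P * P' := Ideal.mul_mono_left inf_le_left
                _ = _ := by ring
      · exact le_inf (Ideal.mul_mono_right Ideal.mul_le_left)
          (Ideal.mul_mono_right Ideal.mul_le_right)
    rw [← hinf]
    ext z
    simp only [Set.mem_ofPred_eq, Set.mem_inter_iff, Submodule.mem_inf]
    tauto

end Counting

end QuadBasis

/-! ### The Kronecker symbol and its divisor sums -/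

theorem kroneckerSym_mul (D : ℤ) {m n : ℕ} (hm : m ≠ 0) (hn : n ≠ 0) :
    kroneckerSym D (m * n) = kroneckerSym D m * kroneckerSym D n := by
  have hm' : NeZero (m / 2 ^ m.factorization 2) := ⟨(Nat.ordCompl_pos 2 hm).ne'⟩
  have hn' : NeZero (n / 2 ^ n.factorization 2) := ⟨(Nat.ordCompl_pos 2 hn).ne'⟩
  simp only [kroneckerSym, if_neg hm, if_neg hn, if_neg (mul_ne_zero hm hn)]
  rw [Nat.ordCompl_mul, jacobiSym.mul_right, Nat.factorization_mul hm hn, Finsupp.add_apply,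
    pow_add]
  ring

theorem kroneckerSym_one (D : ℤ) : kroneckerSym D 1 = 1 := by
  simp [kroneckerSym]

theorem kroneckerSym_two (D : ℤ) : kroneckerSym D 2 = ZMod.χ₈ (D : ZMod 8) := by
  have : (2 : ℕ).factorization 2 = 1 := Nat.prime_two.factorization_self
  simp [kroneckerSym, this]

theorem kroneckerSym_odd_prime (D : ℤ) {p : ℕ} [Fact p.Prime] (hp : p ≠ 2) :
    kroneckerSym D p = legendreSym p D := by
  have hpp : p.Prime := Fact.out
  have : p.factorization 2 = 0 := by
    apply Nat.factorization_eq_zero_of_not_dvd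
    rwa [Nat.prime_dvd_prime_iff_eq Nat.prime_two hpp, eq_comm]
  simp [kroneckerSym, this, hpp.ne_zero, jacobiSym.legendreSym.to_jacobiSym]

/-- The Kronecker symbol `(D / p)` counts the roots of `X² - e X - k` modulo `p`, where
`D = e + 4 k`. -/
theorem kroneckerSym_prime_cases {D e k : ℤ} (hD : e ^ 2 + 4 * k = D) (he : e = 0 ∨ e = 1) {p : ℕ}
    (hp : p.Prime) :
    (kroneckerSym D p = 1 ∧ ∃ t : ℤ, (p : ℤ) ∣ t ^ 2 - e * t - k ∧ ¬ (p : ℤ) ∣ 2 * t - e) ∨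
    (kroneckerSym D p = 0 ∧ ∃ t : ℤ, (p : ℤ) ∣ t ^ 2 - e * t - k ∧ (p : ℤ) ∣ 2 * t - e) ∨
    (kroneckerSym D p = -1 ∧ ∀ t : ℤ, ¬ (p : ℤ) ∣ t ^ 2 - e * t - k) := by
  have : Fact p.Prime := ⟨hp⟩
  rcases eq_or_ne p 2 with rfl | hp2
  · rw [kroneckerSym_two]
    rcases he with rfl | rfl
    · right; left
      -- Modulo `2` every element is its own square, so `k` is a root of `X² - k`.
      refine ⟨?_, k, ?_, ?_⟩
      · rw [← hD, ZMod.χ₈_int_eq_if_mod_eight, if_pos (by omega)]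
      · have := Int.even_mul_pred_self k
        rw [even_iff_two_dvd] at this
        rw [show k ^ 2 - 0 * k - k = k * (k - 1) by ring]
        exact this
      · exact ⟨k, by push_cast; ring⟩
    · rcases Int.even_or_odd k with hk | hk
      · left
        refine ⟨?_, 0, ?_, ?_⟩
        · obtain ⟨r, rfl⟩ := hk
          have h1 : ¬ D % 2 = 0 := by omega
          have h2 : D % 8 = 1 ∨ D % 8 = 7 := by omega
          rw [ZMod.χ₈_int_eq_if_mod_eight, if_neg h1, if_pos h2]
        · simpa using hk.two_dvd
        · norm_num
      · right; right
        refine ⟨?_, fun t ht => ?_⟩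
        · obtain ⟨r, rfl⟩ := hk
          rw [← hD, ZMod.χ₈_int_eq_if_mod_eight, if_neg (by omega), if_neg]
          omega
        · have h1 := Int.even_mul_pred_self t
          rw [Nat.cast_two, ← even_iff_two_dvd, show t ^ 2 - 1 * t - k = t * (t - 1) - k by ring,
            Int.even_sub] at ht
          exact (Int.not_even_iff_odd.mpr hk) (ht.mp h1)
  · have hp2' : ¬ (p : ℤ) ∣ 2 := by
      intro h
      have : p ∣ 2 := by exact_mod_cast h
      exact hp2 ((Nat.prime_dvd_prime_iff_eq hp Nat.prime_two).mp this)
    have hpZ : Prime (p : ℤ) := Nat.prime_iff_prime_int.mp hp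
    -- Completing the square, as `4` is invertible modulo an odd prime.
    have hroot : ∀ t : ℤ, (p : ℤ) ∣ t ^ 2 - e * t - k ↔ (p : ℤ) ∣ (2 * t - e) ^ 2 - D := by
      intro t
      rw [show (2 * t - e) ^ 2 - D = 2 * (2 * (t ^ 2 - e * t - k)) by rw [← hD]; ring,
        hpZ.dvd_mul, hpZ.dvd_mul]
      tauto
    rw [kroneckerSym_odd_prime D hp2]
    by_cases hsq : IsSquare (D : ZMod p)
    · obtain ⟨s, hs⟩ := hsq
      obtain ⟨s, rfl⟩ := ZMod.intCast_surjective s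
      have hs : (p : ℤ) ∣ s ^ 2 - D := by
        rw [← ZMod.intCast_zmod_eq_zero_iff_dvd]
        push_cast
        rw [hs]; ring
      -- With `p = 2q + 1`, `q + 1` inverts `2` modulo `p`, so `(e + s)(q + 1)` is the root `(e +
      -- s)/2`.
      obtain ⟨q, hq⟩ := hp.odd_of_ne_two hp2
      have ht : 2 * ((e + s) * (q + 1)) - e = s + p * (e + s) := by
        rw [hq]; push_cast; ring
      have hroot' : (p : ℤ) ∣ ((e + s) * (q + 1)) ^ 2 - e * ((e + s) * (q + 1)) - k := by
        rw [hroot, ht]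
        obtain ⟨r, hr⟩ := hs
        exact ⟨r + 2 * s * (e + s) + p * (e + s) ^ 2, by linear_combination hr⟩
      have hdvd : (p : ℤ) ∣ 2 * ((e + s) * (q + 1)) - e ↔ (p : ℤ) ∣ D := by
        rw [ht, Int.dvd_add_left (dvd_mul_right _ _)]
        constructor
        · intro h
          exact (Int.dvd_iff_dvd_of_dvd_sub hs).mp (dvd_pow h two_ne_zero)
        · intro h
          exact hpZ.dvd_of_dvd_pow ((Int.dvd_iff_dvd_of_dvd_sub hs).mpr h)
      by_cases hpD : (p : ℤ) ∣ D
      · right; left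
        refine ⟨?_, _, hroot', hdvd.mpr hpD⟩
        rwa [legendreSym.eq_zero_iff, ZMod.intCast_zmod_eq_zero_iff_dvd]
      · left
        refine ⟨?_, _, hroot', fun h => hpD (hdvd.mp h)⟩
        rw [legendreSym.eq_one_iff p (by rwa [Ne, ZMod.intCast_zmod_eq_zero_iff_dvd])]
        refine ⟨s, ?_⟩
        rw [← ZMod.intCast_zmod_eq_zero_iff_dvd] at hs
        push_cast at hs
        linear_combination -hs
    · right; right
      refine ⟨(legendreSym.eq_neg_one_iff p).mpr hsq, fun t ht => hsq ⟨((2 * t - e : ℤ) : ZMod p), ?_⟩⟩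
      rw [hroot, ← ZMod.intCast_zmod_eq_zero_iff_dvd] at ht
      push_cast at ht ⊢
      linear_combination -ht

/-- The recursion satisfied by the divisor sums of the Kronecker symbol. -/
theorem sum_divisors_kroneckerSym_mul (D : ℤ) {p n : ℕ} (hp : p.Prime) (hn : n ≠ 0) :
    ∑ t ∈ (p * n).divisors, kroneckerSym D t +
        kroneckerSym D p * (if p ∣ n then ∑ t ∈ (n / p).divisors, kroneckerSym D t else 0) =
      (1 + kroneckerSym D p) * ∑ t ∈ n.divisors, kroneckerSym D t := by
  -- Divisors are split by whether `p` divides them: those divisible by `p` are `p` times the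
  -- divisors of `m`, and the others are the same for `pn` and `n` (`hcop`).
  have key : ∀ m : ℕ, m ≠ 0 → ∑ t ∈ (p * m).divisors with p ∣ t, kroneckerSym D t =
      kroneckerSym D p * ∑ t ∈ m.divisors, kroneckerSym D t := by
    intro m hm
    rw [Finset.mul_sum]
    symm
    refine Finset.sum_bij (fun t _ => p * t) ?_ ?_ ?_ ?_
    · intro t ht
      rw [Nat.mem_divisors] at ht
      simp [Nat.mul_dvd_mul_left p ht.1, hm, hp.ne_zero]
    · intro a _ b _ h
      exact Nat.eq_of_mul_eq_mul_left hp.pos h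
    · intro b hb
      rw [Finset.mem_filter, Nat.mem_divisors] at hb
      obtain ⟨⟨hb, -⟩, c, rfl⟩ := hb
      exact ⟨c, by simp [hm, Nat.dvd_of_mul_dvd_mul_left hp.pos hb], rfl⟩
    · intro t ht
      rw [kroneckerSym_mul D hp.ne_zero (Nat.pos_of_mem_divisors ht).ne']
  have hcop : ∑ t ∈ (p * n).divisors with ¬ p ∣ t, kroneckerSym D t =
      ∑ t ∈ n.divisors with ¬ p ∣ t, kroneckerSym D t := by
    congr 1
    ext t
    simp only [Finset.mem_filter, Nat.mem_divisors]
    constructor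
    · rintro ⟨⟨h1, -⟩, h2⟩
      exact ⟨⟨((hp.coprime_iff_not_dvd.mpr h2).symm).dvd_of_dvd_mul_left h1, hn⟩, h2⟩
    · rintro ⟨⟨h1, -⟩, h2⟩
      exact ⟨⟨h1.mul_left p, mul_ne_zero hp.ne_zero hn⟩, h2⟩
  have hdiv : kroneckerSym D p *
      (if p ∣ n then ∑ t ∈ (n / p).divisors, kroneckerSym D t else 0) =
      ∑ t ∈ n.divisors with p ∣ t, kroneckerSym D t := by
    split_ifs with h
    · obtain ⟨m, rfl⟩ := h
      rw [Nat.mul_div_cancel_left _ hp.pos, key m (right_ne_zero_of_mul hn)]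
    · rw [mul_zero, Finset.filter_false_of_mem, Finset.sum_empty]
      intro t ht hpt
      exact h (hpt.trans (Nat.dvd_of_mem_divisors ht))
  have s1 := Finset.sum_filter_add_sum_filter_not (p * n).divisors (p ∣ ·) (kroneckerSym D)
  have s2 := Finset.sum_filter_add_sum_filter_not n.divisors (p ∣ ·) (kroneckerSym D)
  rw [key n hn, hcop] at s1
  rw [hdiv]
  linear_combination s2 - s1

/-! ### Splitting of primes and the value of the Kronecker symbol -/

namespace QuadBasis

section Splitting

variable {R : Type*} [CommRing R] [IsDedekindDomain R] [CharZero R] [Module.Free ℤ R]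
  [Module.Finite ℤ R] {e k : ℤ} {D : ℤ}

theorem elt_mem_span_iff (S : QuadBasis R e k) {p : ℕ} {x y : ℤ} :
    S.elt x y ∈ Ideal.span {(p : R)} ↔ (p : ℤ) ∣ x ∧ (p : ℤ) ∣ y := by
  rw [Ideal.mem_span_singleton]
  constructor
  · rintro ⟨c, hc⟩
    obtain ⟨u, v, rfl⟩ := S.exists_eq_elt c
    rw [← Int.cast_natCast, intCast_mul_elt, elt_inj] at hc
    exact ⟨⟨u, hc.1⟩, ⟨v, hc.2⟩⟩
  · rintro ⟨⟨u, rfl⟩, ⟨v, rfl⟩⟩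
    exact ⟨S.elt u v, by rw [← Int.cast_natCast (R := R), intCast_mul_elt]⟩

theorem not_mem_span_of_one (S : QuadBasis R e k) {p : ℕ} (hp : p.Prime) (x : ℤ) :
    S.elt x 1 ∉ Ideal.span {(p : R)} := by
  rw [elt_mem_span_iff]
  rintro ⟨-, h⟩
  exact (Nat.prime_iff_prime_int.mp hp).not_dvd_one h

/-- `(ω - t)(ω + t - e) = -(t² - et - k)`: a root modulo `p` gives zero divisors modulo `p`. -/
theorem mul_mem_span_of_root (S : QuadBasis R e k) {p : ℕ} {t : ℤ} (ht : (p : ℤ) ∣ t ^ 2 - e * t - k) :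
    S.elt (-t) 1 * S.elt (t - e) 1 ∈ Ideal.span {(p : R)} := by
  rw [elt_mul, elt_mem_span_iff]
  exact ⟨ht.elim fun c hc => ⟨-c, by linear_combination -hc⟩, ⟨0, by ring⟩⟩

theorem not_isPrime_of_root (S : QuadBasis R e k) {p : ℕ} (hp : p.Prime) {t : ℤ} (ht : (p : ℤ) ∣ t ^ 2 - e * t - k) :
    ¬ (Ideal.span {(p : R)}).IsPrime := fun h =>
  (h.mem_or_mem (S.mul_mem_span_of_root ht)).elim (S.not_mem_span_of_one hp _)
    (S.not_mem_span_of_one hp _)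

/-- As `N(P) = p`, some `x + yω ∈ P` is outside `(p)`. Its norm vanishes modulo `p`, which forces `p
∤ y`, and `-x/y` is a root. -/
theorem exists_root (S : QuadBasis R e k) {p : ℕ} (hp : p.Prime) {P P' : Ideal R} (hP : P ≠ ⊤) (hP' : P' ≠ ⊤)
    (h : Ideal.span {(p : R)} = P * P') : ∃ t : ℤ, (p : ℤ) ∣ t ^ 2 - e * t - k := by
  have hpZ : Prime (p : ℤ) := Nat.prime_iff_prime_int.mp hp
  have hPn := (S.absNorm_eq_of_span_eq_mul hp hP hP' h).1
  have hle : Ideal.span {(p : R)} ≤ P := h ▸ Ideal.mul_le_left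
  obtain ⟨z, hzP, hz⟩ : ∃ z ∈ P, z ∉ Ideal.span {(p : R)} := by
    by_contra! hcon
    have := S.absNorm_span_prime p
    rw [le_antisymm hle hcon, hPn] at this
    have h2 := hp.two_le
    nlinarith
  obtain ⟨x, y, rfl⟩ := S.exists_eq_elt z
  have hdvd := Ideal.absNorm_dvd_norm_of_mem hzP
  rw [hPn, norm_elt] at hdvd
  rw [elt_mem_span_iff] at hz
  have hy : ¬ (p : ℤ) ∣ y := by
    intro hy
    refine hz ⟨hpZ.dvd_of_dvd_pow (n := 2) ?_, hy⟩
    have : (p : ℤ) ∣ e * x * y - k * y ^ 2 :=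
      dvd_sub (hy.mul_left _) ((dvd_pow hy two_ne_zero).mul_left _)
    rwa [add_sub_assoc, Int.dvd_add_left this] at hdvd
  obtain ⟨u, v, huv⟩ := (Prime.coprime_iff_not_dvd hpZ).mpr hy
  obtain ⟨c, hc⟩ := hdvd
  refine ⟨-(x * v), c * v ^ 2 + u * (e * x * v - k * (1 + v * y)), ?_⟩
  linear_combination v ^ 2 * hc - (e * x * v - k * (1 + v * y)) * huv

theorem kroneckerSym_of_inert (S : QuadBasis R e k) (hD : e ^ 2 + 4 * k = D) (he : e = 0 ∨ e = 1) {p : ℕ} (hp : p.Prime)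
    (h : (Ideal.span {(p : R)}).IsPrime) : kroneckerSym D p = -1 := by
  rcases kroneckerSym_prime_cases hD he hp with ⟨-, t, ht, -⟩ | ⟨-, t, ht, -⟩ | ⟨h1, -⟩
  · exact absurd h (S.not_isPrime_of_root hp ht)
  · exact absurd h (S.not_isPrime_of_root hp ht)
  · exact h1

theorem ne_bot_of_span_eq_mul {p : ℕ} (hp : p.Prime) {P P' : Ideal R}
    (h : Ideal.span {(p : R)} = P * P') : P ≠ ⊥ ∧ P' ≠ ⊥ := by
  have hpR : (p : R) ≠ 0 := by exact_mod_cast hp.ne_zero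
  have : P * P' ≠ 0 := by
    rw [← h]; simpa using hpR
  exact ⟨left_ne_zero_of_mul this, right_ne_zero_of_mul this⟩

theorem kroneckerSym_of_split (S : QuadBasis R e k) (hD : e ^ 2 + 4 * k = D) (he : e = 0 ∨ e = 1) {p : ℕ} (hp : p.Prime)
    {P P' : Ideal R} (hP : P.IsPrime) (hP' : P'.IsPrime) (hne : P ≠ P')
    (h : Ideal.span {(p : R)} = P * P') : kroneckerSym D p = 1 := by
  obtain ⟨hP0, hP0'⟩ := ne_bot_of_span_eq_mul hp h
  rcases kroneckerSym_prime_cases hD he hp with ⟨h1, -⟩ | ⟨-, t, ht, ht'⟩ | ⟨-, h1⟩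
  · exact h1
  · exfalso
    -- A double root makes `ω - t` nilpotent modulo `p`, but `(p) = P ∩ P'` is radical.
    have hsq : S.elt (-t) 1 ^ 2 ∈ Ideal.span {(p : R)} := by
      rw [pow_two, elt_mul, elt_mem_span_iff]
      constructor
      · obtain ⟨c, hc⟩ := ht
        obtain ⟨c', hc'⟩ := ht'
        exact ⟨t * c' - c, by linear_combination t * hc' - hc⟩
      · obtain ⟨c', hc'⟩ := ht'
        exact ⟨-c', by linear_combination -hc'⟩
    have hcop := Ideal.isCoprime_iff_sup_eq.mpr
      (Ideal.IsMaximal.coprime_of_ne (hP.isMaximal hP0) (hP'.isMaximal hP0') hne)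
    apply S.not_mem_span_of_one hp (-t)
    rw [h, Ideal.mul_eq_inf_of_isCoprime hcop]
    rw [h] at hsq
    exact ⟨hP.mem_of_pow_mem _ (Ideal.mul_le_left hsq), hP'.mem_of_pow_mem _ (Ideal.mul_le_right hsq)⟩
  · obtain ⟨t, ht⟩ := S.exists_root hp hP.ne_top hP'.ne_top h
    exact absurd ht (h1 t)

theorem kroneckerSym_of_ramified (S : QuadBasis R e k) (hD : e ^ 2 + 4 * k = D) (he : e = 0 ∨ e = 1) {p : ℕ}
    (hp : p.Prime) {P : Ideal R} (hP : P.IsPrime) (h : Ideal.span {(p : R)} = P ^ 2) :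
    kroneckerSym D p = 0 := by
  have hPP : Ideal.span {(p : R)} = P * P := by rw [h, pow_two]
  have hP0 := (ne_bot_of_span_eq_mul hp hPP).1
  rcases kroneckerSym_prime_cases hD he hp with ⟨-, t, ht, ht'⟩ | ⟨h1, -⟩ | ⟨-, h1⟩
  · exfalso
    have hmul := S.mul_mem_span_of_root ht
    have hmul' := hmul
    have n1 := S.not_mem_span_of_one hp (-t)
    have n2 := S.not_mem_span_of_one hp (t - e)
    rw [mul_comm] at hmul'
    rw [h] at hmul hmul' n1 n2
    -- The product lies in `P²` and neither factor does, so both lie in `P`. Their difference `2t -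
    -- e` is then in `P` too; for a simple root it is prime to `p`, so `1 ∈ P`.
    have m1 := Ideal.mem_prime_of_mul_mem_pow (i := 1) hP0 n1 hmul
    have m2 := Ideal.mem_prime_of_mul_mem_pow (i := 1) hP0 n2 hmul'
    have hpP : ((p : ℤ) : R) ∈ P := by
      rw [Int.cast_natCast, ← Ideal.span_singleton_le_iff_mem, hPP]
      exact Ideal.mul_le_left
    have hdiff : ((2 * t - e : ℤ) : R) ∈ P := by
      have := P.sub_mem m1 m2
      simp only [elt] at this
      convert this using 1
      push_cast; ring
    obtain ⟨u, v, huv⟩ :=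
      (Prime.coprime_iff_not_dvd (Nat.prime_iff_prime_int.mp hp)).mpr ht'
    apply hP.ne_top
    rw [Ideal.eq_top_iff_one]
    have := P.add_mem (P.mul_mem_left (u : R) hpP) (P.mul_mem_left (v : R) hdiff)
    rw [← Int.cast_mul, ← Int.cast_mul, ← Int.cast_add, huv, Int.cast_one] at this
    exact this
  · exact h1
  · obtain ⟨t, ht⟩ := S.exists_root hp hP.ne_top hP.ne_top hPP
    exact absurd ht (h1 t)

/-- As `N((p)) = p²`, a proper factorization has both factors of norm `p`, hence prime. -/
theorem isPrime_or_exists_mul (S : QuadBasis R e k) {p : ℕ} (hp : p.Prime) :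
    (Ideal.span {(p : R)}).IsPrime ∨ ∃ P P' : Ideal R, P.IsPrime ∧ P'.IsPrime ∧
      Ideal.span {(p : R)} = P * P' := by
  refine or_iff_not_imp_left.mpr fun hnot => ?_
  have htop : Ideal.span {(p : R)} ≠ ⊤ := by
    rw [Ne, ← Ideal.absNorm_eq_one_iff, S.absNorm_span_prime]
    have := hp.two_le
    nlinarith
  obtain ⟨P, hP, hle⟩ := Ideal.exists_le_maximal _ htop
  obtain ⟨P', hPP'⟩ := Ideal.dvd_iff_le.mpr hle
  have hP' : P' ≠ ⊤ := by
    rintro rfl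
    rw [Ideal.mul_top] at hPP'
    exact hnot (hPP' ▸ hP.isPrime)
  have hn := (S.absNorm_eq_of_span_eq_mul hp hP.ne_top hP' hPP').2
  refine ⟨P, P', hP.isPrime, Ideal.isPrime_of_irreducible_absNorm ?_, hPP'⟩
  rw [hn]
  exact hp

end Splitting

end QuadBasis

/-! ### The ring of integers of `ℚ(√D)` -/

/-- The square of the denominator of `w` must divide `d`. -/
theorem exists_int_of_squarefree_mul_sq {d : ℤ} (hd : Squarefree d) {w : ℚ} {M : ℤ}
    (h : (d : ℚ) * w ^ 2 = M) : ∃ r : ℤ, w = r := by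
  have hden : (w.den : ℚ) ≠ 0 := by exact_mod_cast w.den_ne_zero
  have hw : w * w.den = w.num := Rat.mul_den_eq_num w
  have h1 : d * w.num ^ 2 = M * (w.den : ℤ) ^ 2 := by
    have : (d : ℚ) * w.num ^ 2 = M * (w.den : ℚ) ^ 2 := by
      rw [← hw, ← h]; ring
    exact_mod_cast this
  have hcop : IsCoprime ((w.den : ℤ) ^ 2) (w.num ^ 2) := by
    apply IsCoprime.pow
    rw [Int.isCoprime_iff_gcd_eq_one, Int.gcd_comm]
    exact w.reduced
  have hdvd : (w.den : ℤ) * w.den ∣ d := by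
    rw [← pow_two]
    exact hcop.dvd_of_dvd_mul_right ⟨M, by rw [h1]; ring⟩
  have hden1 : w.den = 1 := by
    have := Int.isUnit_iff.mp (hd _ hdvd)
    omega
  exact ⟨w.num, (Rat.coe_int_num_of_den_eq_one hden1).symm⟩

/-- The half-integers that can occur as coordinates of algebraic integers in a quadratic field. -/
theorem exists_coords_of_trace_norm {D e k : ℤ} (hfund : IsFundamentalDiscriminant D)
    (hD : e ^ 2 + 4 * k = D) (he : e = 0 ∨ e = 1) {u v : ℚ} {U N : ℤ} (hU : 2 * u = U)
    (hN : u ^ 2 - D * v ^ 2 = N) : ∃ x y : ℤ, 2 * v = y ∧ u = x + y * e / 2 := by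
  have hM : (D : ℚ) * (2 * v) ^ 2 = ((U ^ 2 - 4 * N : ℤ) : ℚ) := by
    push_cast; rw [← hU, ← hN]; ring
  suffices h : ∃ x y : ℤ, 2 * v = y ∧ U = 2 * x + y * e by
    obtain ⟨x, y, hy, hx⟩ := h
    refine ⟨x, y, hy, ?_⟩
    rw [hx] at hU
    push_cast at hU
    linear_combination hU / 2
  rcases hfund with ⟨h4, hsq⟩ | ⟨m, rfl, hm, hsq⟩
  · obtain ⟨w, hw⟩ := exists_int_of_squarefree_mul_sq hsq hM
    have he1 : e = 1 := by
      rcases he with rfl | rfl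
      · omega
      · rfl
    subst he1
    rw [hw] at hM
    have hM : D * w ^ 2 = U ^ 2 - 4 * N := by exact_mod_cast hM
    have hpar : Even (U - w) := by
      have h2 : Even (U ^ 2 - w ^ 2) := ⟨2 * (k * w ^ 2 + N), by rw [← hD] at hM; linarith⟩
      rwa [Int.even_sub, Int.even_pow' two_ne_zero, Int.even_pow' two_ne_zero, ← Int.even_sub] at h2
    obtain ⟨x, hx⟩ := hpar
    exact ⟨x, w, hw, by omega⟩
  · have he0 : e = 0 := by
      rcases he with rfl | rfl
      · rfl
      · omega
    subst he0
    have hM' : (m : ℚ) * (2 * (2 * v)) ^ 2 = ((U ^ 2 - 4 * N : ℤ) : ℚ) := by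
      rw [← hM]; push_cast; ring
    obtain ⟨r, hr⟩ := exists_int_of_squarefree_mul_sq hsq hM'
    rw [hr] at hM'
    have hM' : m * r ^ 2 = U ^ 2 - 4 * N := by exact_mod_cast hM'
    -- For `m ≡ 2, 3` modulo `4`, the congruence `m r² ≡ U²` modulo `4` forces `r` and `U` to be
    -- even.
    have hsq4 : ∀ z : ℤ, (∃ c, z = 2 * c ∧ z ^ 2 % 4 = 0) ∨ (∃ c, z ^ 2 = 4 * c + 1) := by
      intro z
      rcases Int.even_or_odd' z with ⟨c, rfl | rfl⟩
      · exact Or.inl ⟨c, rfl, by ring_nf; omega⟩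
      · exact Or.inr ⟨c ^ 2 + c, by ring⟩
    rcases hsq4 r with ⟨c, rfl, -⟩ | ⟨c, hc⟩
    · rcases hsq4 U with ⟨x, hx, -⟩ | ⟨x, hx⟩
      · refine ⟨x, c, ?_, by omega⟩
        push_cast at hr
        linarith
      · exfalso
        have : m * (2 * c) ^ 2 = 4 * (m * c ^ 2) := by ring
        omega
    · exfalso
      rw [hc, show m * (4 * c + 1) = 4 * (m * c) + m by ring] at hM'
      rcases hsq4 U with ⟨x, -, hx⟩ | ⟨x, hx⟩ <;> omega

section QuadField

variable {D e k : ℤ}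

theorem sqrtDisc_sq (hneg : D < 0) : (((√(-(D : ℝ)) : ℝ) : ℂ) * Complex.I) ^ 2 = D := by
  have h : (0 : ℝ) ≤ -(D : ℝ) := by
    have : (D : ℝ) < 0 := by exact_mod_cast hneg
    linarith
  rw [mul_pow, Complex.I_sq, ← Complex.ofReal_pow, Real.sq_sqrt h]
  push_cast; ring

theorem quadField.exists_coords (hneg : D < 0) {z : ℂ} (hz : z ∈ quadField D) :
    ∃ u v : ℚ, z = u + v * (((√(-(D : ℝ)) : ℝ) : ℂ) * Complex.I) := by
  have hsq := sqrtDisc_sq hneg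
  have halg : IsAlgebraic ℚ (((√(-(D : ℝ)) : ℝ) : ℂ) * Complex.I) := by
    refine (IsIntegral.of_pow (n := 2) (by norm_num) ?_).isAlgebraic
    rw [hsq, show (D : ℂ) = algebraMap ℚ ℂ D by simp]
    exact isIntegral_algebraMap
  rw [← IntermediateField.mem_toSubalgebra,
    IntermediateField.adjoin_simple_toSubalgebra_of_isAlgebraic halg] at hz
  induction hz using Algebra.adjoin_induction with
  | mem x hx =>
    rw [Set.mem_singleton_iff] at hx
    exact ⟨0, 1, by rw [hx]; simp⟩
  | algebraMap r => exact ⟨r, 0, by simp⟩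
  | add x y _ _ hx hy =>
    obtain ⟨u, v, rfl⟩ := hx
    obtain ⟨u', v', rfl⟩ := hy
    exact ⟨u + u', v + v', by push_cast; ring⟩
  | mul x y _ _ hx hy =>
    obtain ⟨u, v, rfl⟩ := hx
    obtain ⟨u', v', rfl⟩ := hy
    refine ⟨u * u' + D * v * v', u * v' + v * u', ?_⟩
    push_cast
    linear_combination (v * v' : ℂ) * hsq

theorem exists_int_of_isIntegral_ratCast {q : ℚ} (h : IsIntegral ℤ (q : ℂ)) :
    ∃ n : ℤ, q = n := by
  have h' : IsIntegral ℤ (algebraMap ℚ ℂ q) := by simpa using h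
  rw [isIntegral_algebraMap_iff (algebraMap ℚ ℂ).injective] at h'
  obtain ⟨n, hn⟩ := IsIntegrallyClosed.isIntegral_iff.mp h'
  exact ⟨n, by simpa using hn.symm⟩

/-- The integral generator `ω = (e + √D) / 2`. -/
def omegaC (D e : ℤ) : ℂ := (e + ((√(-(D : ℝ)) : ℝ) : ℂ) * Complex.I) / 2

theorem omegaC_mul_self (hneg : D < 0) (hD : e ^ 2 + 4 * k = D) :
    omegaC D e * omegaC D e = e * omegaC D e + k := by
  have hsq := sqrtDisc_sq hneg
  have hD' : (e : ℂ) ^ 2 + 4 * k = D := by exact_mod_cast hD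
  simp only [omegaC]
  linear_combination hsq / 4 - hD' / 4

theorem omegaC_mem (D e : ℤ) : omegaC D e ∈ quadField D := by
  have h1 : ((√(-(D : ℝ)) : ℝ) : ℂ) * Complex.I ∈ quadField D :=
    IntermediateField.mem_adjoin_simple_self ℚ _
  exact div_mem (add_mem (intCast_mem _ e) h1) (ofNat_mem _ 2)

theorem isIntegral_omegaC (hneg : D < 0) (hD : e ^ 2 + 4 * k = D) :
    IsIntegral ℤ (omegaC D e) := by
  refine ⟨Polynomial.X ^ 2 + (Polynomial.C (-e) * Polynomial.X + Polynomial.C (-k)),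
    Polynomial.monic_X_pow_add (lt_of_le_of_lt Polynomial.degree_linear_le (by norm_num)), ?_⟩
  simp only [Polynomial.eval₂_add, Polynomial.eval₂_mul, Polynomial.eval₂_pow, Polynomial.eval₂_X,
    Polynomial.eval₂_C]
  simp only [map_neg, eq_intCast]
  linear_combination omegaC_mul_self hneg hD

theorem omegaC_im (D e : ℤ) : (omegaC D e).im = √(-(D : ℝ)) / 2 := by
  rw [omegaC, show ((2 : ℂ)) = ((2 : ℝ) : ℂ) by norm_num, Complex.div_ofReal_im]
  simp

theorem sqrt_pos (hneg : D < 0) : 0 < √(-(D : ℝ)) := by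
  apply Real.sqrt_pos.mpr
  have : (D : ℝ) < 0 := by exact_mod_cast hneg
  linarith

/-- The trace `2u` and the norm `u² - Dv²` of `u + v√D` are rational algebraic integers, hence
integers; `exists_coords_of_trace_norm` then finds the coordinates. -/
theorem exists_eq_of_isIntegral (hfund : IsFundamentalDiscriminant D) (hneg : D < 0)
    (hD : e ^ 2 + 4 * k = D) (he : e = 0 ∨ e = 1) {z : ℂ} (hz : z ∈ quadField D)
    (hint : IsIntegral ℤ z) : ∃ x y : ℤ, z = x + y * omegaC D e := by
  have hsq := sqrtDisc_sq hneg
  obtain ⟨u, v, rfl⟩ := quadField.exists_coords hneg hz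
  have hconj : IsIntegral ℤ ((u : ℂ) - v * (((√(-(D : ℝ)) : ℝ) : ℂ) * Complex.I)) := by
    have := hint.map (starRingEnd ℂ).toIntAlgHom
    simpa [sub_eq_add_neg] using this
  obtain ⟨U, hU⟩ : ∃ U : ℤ, 2 * u = U := by
    apply exists_int_of_isIntegral_ratCast
    have h := hint.add hconj
    rwa [add_add_sub_cancel, ← two_mul, ← Rat.cast_ofNat, ← Rat.cast_mul] at h
  obtain ⟨N, hN⟩ : ∃ N : ℤ, u ^ 2 - D * v ^ 2 = N := by
    apply exists_int_of_isIntegral_ratCast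
    have h := hint.mul hconj
    have heq : ((u ^ 2 - D * v ^ 2 : ℚ) : ℂ) =
        (u + v * (((√(-(D : ℝ)) : ℝ) : ℂ) * Complex.I)) *
          (u - v * (((√(-(D : ℝ)) : ℝ) : ℂ) * Complex.I)) := by
      push_cast
      linear_combination (v ^ 2 : ℂ) * hsq
    rwa [heq]
  obtain ⟨x, y, hy, hx⟩ := exists_coords_of_trace_norm hfund hD he hU hN
  refine ⟨x, y, ?_⟩
  have hy' : (2 : ℂ) * v = y := by exact_mod_cast congrArg (Rat.cast : ℚ → ℂ) hy
  have hx' : (u : ℂ) = x + y * e / 2 := by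
    rw [hx]; push_cast; ring
  rw [hx', omegaC, ← hy']
  ring

theorem exists_quadBasis (hfund : IsFundamentalDiscriminant D) (hneg : D < 0)
    (hD : e ^ 2 + 4 * k = D) (he : e = 0 ∨ e = 1) :
    ∃ S : QuadBasis (𝓞 (quadField D)) e k, ∀ x y : ℤ,
      (((S.elt x y : 𝓞 (quadField D)) : quadField D) : ℂ) = x + y * omegaC D e := by
  have hω : IsIntegral ℤ (⟨omegaC D e, omegaC_mem D e⟩ : quadField D) :=
    (isIntegral_algebraMap_iff (algebraMap (quadField D) ℂ).injective).mp (isIntegral_omegaC hneg hD)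
  let ω : 𝓞 (quadField D) := ⟨_, hω⟩
  have hcoe : ((ω : quadField D) : ℂ) = omegaC D e := rfl
  have hinj : Function.Injective (fun z : 𝓞 (quadField D) => ((z : quadField D) : ℂ)) :=
    Subtype.val_injective.comp NumberField.RingOfIntegers.coe_injective
  let b : Module.Basis (Fin 2) ℤ (𝓞 (quadField D)) := Module.Basis.mk (v := ![1, ω])
    (by
      rw [LinearIndependent.pair_iff]
      intro x y hxy
      have h := congrArg (fun z : 𝓞 (quadField D) => ((z : quadField D) : ℂ)) hxy
      simp [hcoe] at h
      have him := congrArg Complex.im h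
      have hs := sqrt_pos hneg
      simp [omegaC_im, hs.ne'] at him
      subst him
      simpa using h)
    (by
      rintro z -
      obtain ⟨x, y, hxy⟩ := exists_eq_of_isIntegral hfund hneg hD he (z : quadField D).2
        ((NumberField.RingOfIntegers.isIntegral_coe z).map (quadField D).val.toIntAlgHom)
      have hz : z = x • 1 + y • ω := by
        apply hinj
        simp [hcoe, hxy]
      rw [hz]
      exact Submodule.add_mem _ (Submodule.smul_mem _ _ (Submodule.subset_span ⟨0, rfl⟩))
        (Submodule.smul_mem _ _ (Submodule.subset_span ⟨1, rfl⟩)))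
  have hb0 : b 0 = 1 := by simp [b]
  have hb1 : b 1 = ω := by simp [b]
  refine ⟨⟨b, hb0, ?_⟩, fun x y => ?_⟩
  · rw [hb1]
    apply hinj
    simp [hcoe, omegaC_mul_self hneg hD]
  · simp [QuadBasis.elt, hb1, hcoe]

/-- `Im(β/α)` is the area times the positive factor `√|D| / (2|α|²)`, so the two notions of
orientation agree. -/
theorem isIdealForm_iff (hneg : D < 0) {S : QuadBasis (𝓞 (quadField D)) e k}
    (hS : ∀ x y : ℤ,
      (((S.elt x y : 𝓞 (quadField D)) : quadField D) : ℂ) = x + y * omegaC D e)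
    (I : Ideal (𝓞 (quadField D))) (Q : PosForm D) : IsIdealForm I Q ↔ S.IsNormForm I Q := by
  have hs := sqrt_pos hneg
  have him : ∀ α β : 𝓞 (quadField D), 0 < (((β : quadField D) : ℂ) / (α : quadField D)).im ↔
      0 < S.area α β := by
    intro α β
    obtain ⟨a, b, rfl⟩ := S.exists_eq_elt α
    obtain ⟨c, d, rfl⟩ := S.exists_eq_elt β
    rw [hS, hS, Complex.div_im, ← sub_div, S.area_elt]
    have hnum : ((c : ℂ) + d * omegaC D e).im * ((a : ℂ) + b * omegaC D e).re -
        ((c : ℂ) + d * omegaC D e).re * ((a : ℂ) + b * omegaC D e).im =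
        √(-(D : ℝ)) / 2 * ((a * d - b * c : ℤ) : ℝ) := by
      simp [omegaC_im]
      ring
    rw [hnum]
    -- For `α = 0` both sides are false: the quotient is `0` by convention and the area vanishes.
    rcases eq_or_ne ((a : ℂ) + b * omegaC D e) 0 with h0 | h0
    · have hb := congrArg Complex.im h0
      simp [omegaC_im, hs.ne'] at hb
      subst hb
      have ha : a = 0 := by simpa using h0
      subst ha
      simp
    · rw [div_pos_iff_of_pos_right (Complex.normSq_pos.mpr h0),
        mul_pos_iff_of_pos_left (by positivity), Int.cast_pos]
  constructor
  · rintro ⟨v, hv, hN⟩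
    refine ⟨v 0, v 1, (him _ _).mp hv, QuadBasis.mem_iff_of_basis v, fun x y => ?_⟩
    rw [← hN, zsmul_eq_mul, zsmul_eq_mul]
  · rintro ⟨α, β, hpos, hI, hN⟩
    obtain ⟨v, rfl, rfl⟩ := S.exists_basis hpos.ne' hI
    refine ⟨v, (him _ _).mpr hpos, fun x y => ?_⟩
    rw [← hN, zsmul_eq_mul, zsmul_eq_mul]

end QuadField

/-! ### The principal form and its representations of `1` -/

section PrincipalForm

variable {D e k : ℤ}

/-- The principal form `x² + e x y - k y²`. -/
def principalForm (hD : e ^ 2 + 4 * k = D) (hneg : D < 0) : PosForm D where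
  a := 1
  b := e
  c := -k
  disc_eq := by linear_combination hD
  pos := by
    intro x y hxy
    have h4 : 4 * (1 * x ^ 2 + e * x * y + -k * y ^ 2) = (2 * x + e * y) ^ 2 + (-D) * y ^ 2 := by
      rw [← hD]; ring
    rcases eq_or_ne y 0 with rfl | hy
    · have hx : x ≠ 0 := by rintro rfl; exact hxy rfl
      have := sq_pos_of_ne_zero hx
      nlinarith
    · have := sq_pos_of_ne_zero hy
      nlinarith [sq_nonneg (2 * x + e * y), mul_pos (neg_pos.mpr hneg) this]

/-- A solution with `y ≠ 0` needs `-D ≤ 4`, that is `k = -1`; for `k ≤ -2` only `(±1, 0)` remain. -/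
theorem rep_one_principalForm (hD : e ^ 2 + 4 * k = D) (hneg : D < 0) (he : e = 0 ∨ e = 1) :
    (principalForm hD hneg).rep 1 = wNum D := by
  suffices h : ∃ s : Finset (ℤ × ℤ), s.card = wNum D ∧
      ∀ x y : ℤ, x ^ 2 + e * x * y - k * y ^ 2 = 1 ↔ (x, y) ∈ s by
    obtain ⟨s, hs, hmem⟩ := h
    rw [← hs, PosForm.rep]
    refine Nat.subtype_card s fun v => ?_
    rw [← hmem, PosForm.eval, principalForm]
    simp [sub_eq_add_neg]
  have bound : ∀ z : ℤ, z ^ 2 ≤ 1 → z = -1 ∨ z = 0 ∨ z = 1 := by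
    intro z hz
    have h1 : z ≤ 1 := by nlinarith
    have h2 : -1 ≤ z := by nlinarith
    omega
  rcases he with rfl | rfl
  · by_cases h4 : k = -1
    · subst h4
      refine ⟨{(1, 0), (-1, 0), (0, 1), (0, -1)}, ?_, fun x y => ?_⟩
      · simp [wNum, ← hD]
      · constructor
        · intro h
          rcases bound x (by nlinarith [sq_nonneg y]) with rfl | rfl | rfl <;>
          rcases bound y (by nlinarith) with rfl | rfl | rfl <;> simp_all
        · intro h
          simp at h
          rcases h with ⟨rfl, rfl⟩ | ⟨rfl, rfl⟩ | ⟨rfl, rfl⟩ | ⟨rfl, rfl⟩ <;> norm_num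
    · refine ⟨{(1, 0), (-1, 0)}, ?_, fun x y => ?_⟩
      · rw [wNum, if_neg (by omega), if_neg (by omega)]; rfl
      · have hk : k ≤ -2 := by omega
        constructor
        · intro h
          have hy : y = 0 := by
            by_contra hy
            have := sq_pos_of_ne_zero hy
            nlinarith [sq_nonneg x]
          subst hy
          rcases bound x (by linarith) with rfl | rfl | rfl <;> simp_all
        · intro h
          simp at h
          rcases h with ⟨rfl, rfl⟩ | ⟨rfl, rfl⟩ <;> norm_num
  · by_cases h4 : k = -1
    · subst h4
      refine ⟨{(1, 0), (-1, 0), (0, 1), (0, -1), (1, -1), (-1, 1)}, ?_, fun x y => ?_⟩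
      · simp [wNum, ← hD]
      · constructor
        · intro h
          have hx := bound x (by nlinarith [sq_nonneg (2 * y + x)])
          have hy := bound y (by nlinarith [sq_nonneg (2 * x + y)])
          rcases hx with rfl | rfl | rfl <;> rcases hy with rfl | rfl | rfl <;> simp_all
        · intro h
          simp at h
          rcases h with ⟨rfl, rfl⟩ | ⟨rfl, rfl⟩ | ⟨rfl, rfl⟩ | ⟨rfl, rfl⟩ | ⟨rfl, rfl⟩ |
            ⟨rfl, rfl⟩ <;> norm_num
    · refine ⟨{(1, 0), (-1, 0)}, ?_, fun x y => ?_⟩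
      · rw [wNum, if_neg (by omega), if_neg (by omega)]; rfl
      · have hk : k ≤ -2 := by omega
        constructor
        · intro h
          have hy : y = 0 := by
            by_contra hy
            have := sq_pos_of_ne_zero hy
            nlinarith [sq_nonneg (2 * x + y)]
          subst hy
          rcases bound x (by linarith) with rfl | rfl | rfl <;> simp_all
        · intro h
          simp at h
          rcases h with ⟨rfl, rfl⟩ | ⟨rfl, rfl⟩ <;> norm_num

end PrincipalForm

/-! ### Coefficients of theta series under the Hecke operators -/

@[simp] theorem coeff_theta {D : ℤ} (h : FormClass D) (n : ℕ) :
    PowerSeries.coeff n (theta h) = h.rep n := PowerSeries.coeff_mk _ _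

theorem coeff_opU (p : ℕ) (f : PowerSeries ℤ) (n : ℕ) :
    PowerSeries.coeff n (opU p f) = PowerSeries.coeff (p * n) f := PowerSeries.coeff_mk _ _

theorem coeff_opT (D : ℤ) (p : ℕ) (f : PowerSeries ℤ) (n : ℕ) :
    PowerSeries.coeff n (opT D p f) = PowerSeries.coeff (p * n) f +
      kroneckerSym D p * (if p ∣ n then PowerSeries.coeff (n / p) f else 0) := by
  rw [opT, map_add, map_zsmul, opU, opV, PowerSeries.coeff_mk, PowerSeries.coeff_mk, smul_eq_mul]

theorem opT_sum (D : ℤ) (p : ℕ) {ι : Type*} (s : Finset ι) (f : ι → PowerSeries ℤ) :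
    opT D p (∑ i ∈ s, f i) = ∑ i ∈ s, opT D p (f i) := by
  ext n
  simp only [map_sum, coeff_opT, Finset.sum_add_distrib, ← Finset.mul_sum]
  congr 2
  split_ifs
  · rfl
  · simp

theorem coeff_sum_theta (D : ℤ) (n : ℕ) :
    PowerSeries.coeff n (∑ h : FormClass D, theta h) = totalRep D n := by
  simp [totalRep]

/-! ### The Hecke action on theta series and Gauss's formula -/

namespace QuadBasis

section Hecke

variable {R : Type*} [CommRing R] [IsDedekindDomain R] [CharZero R] [Module.Free ℤ R]
  [Module.Finite ℤ R] {e k D : ℤ} {S : QuadBasis R e k} {f : ClassGroup R ≃ FormClass D}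

/-- The bridge that turns identities of theta coefficients into counts of elements of ideals. -/
theorem rep_classGroup (hf : ∀ (I : (Ideal R)⁰) (Q : PosForm D),
      f (ClassGroup.mk0 I) = ⟦Q⟧ ↔ S.IsNormForm (I : Ideal R) Q) (I : (Ideal R)⁰) (n : ℕ) :
    (f (ClassGroup.mk0 I)).rep n = (normSet (I : Ideal R) n).ncard ∧
      (normSet (I : Ideal R) n).Finite := by
  obtain ⟨Q, hQ⟩ := Quotient.exists_rep (f (ClassGroup.mk0 I))
  have h := (hf I Q).mp hQ.symm
  rw [← hQ]
  exact ⟨h.rep_eq n, h.finite_normSet n⟩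

theorem opT_theta_split (hf : ∀ (I : (Ideal R)⁰) (Q : PosForm D),
      f (ClassGroup.mk0 I) = ⟦Q⟧ ↔ S.IsNormForm (I : Ideal R) Q)
    (hD : e ^ 2 + 4 * k = D) (he : e = 0 ∨ e = 1) {p : ℕ} (hp : p.Prime) (h : FormClass D)
    {P P' : (Ideal R)⁰} (hP : (P : Ideal R).IsPrime) (hP' : (P' : Ideal R).IsPrime) (hne : P ≠ P')
    (hpP : Ideal.span {(p : R)} = (P : Ideal R) * P') :
    opT D p (theta h) = theta (f (f.symm h * ClassGroup.mk0 P)) +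
      theta (f (f.symm h * ClassGroup.mk0 P')) := by
  have hne' : (P : Ideal R) ≠ P' := fun h => hne (Subtype.ext h)
  obtain ⟨I, hI⟩ := ClassGroup.mk0_surjective (f.symm h)
  obtain rfl : f (ClassGroup.mk0 I) = h := by rw [hI, Equiv.apply_symm_apply]
  rw [Equiv.symm_apply_apply, ← map_mul, ← map_mul]
  ext n
  have key := S.ncard_normSet_split (nonZeroDivisors.ne_zero I.2) hp hP hP' hne' hpP n
    (rep_classGroup hf I _).2
  simp only [coeff_opT, map_add, coeff_theta, (rep_classGroup hf _ _).1,
    S.kroneckerSym_of_split hD he hp hP hP' hne' hpP, one_mul, Submonoid.coe_mul]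
  exact_mod_cast key

theorem opT_theta_ramified (hf : ∀ (I : (Ideal R)⁰) (Q : PosForm D),
      f (ClassGroup.mk0 I) = ⟦Q⟧ ↔ S.IsNormForm (I : Ideal R) Q)
    (hD : e ^ 2 + 4 * k = D) (he : e = 0 ∨ e = 1) {p : ℕ} (hp : p.Prime) (h : FormClass D)
    {P : (Ideal R)⁰} (hP : (P : Ideal R).IsPrime)
    (hpP : Ideal.span {(p : R)} = (P : Ideal R) ^ 2) :
    opT D p (theta h) = opU p (theta h) ∧
      opU p (theta h) = theta (f (f.symm h * ClassGroup.mk0 P)) := by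
  refine ⟨by rw [opT, S.kroneckerSym_of_ramified hD he hp hP hpP, zero_smul, add_zero], ?_⟩
  obtain ⟨I, hI⟩ := ClassGroup.mk0_surjective (f.symm h)
  obtain rfl : f (ClassGroup.mk0 I) = h := by rw [hI, Equiv.apply_symm_apply]
  rw [Equiv.symm_apply_apply, ← map_mul]
  ext n
  simp only [coeff_opU, coeff_theta, (rep_classGroup hf _ _).1, Submonoid.coe_mul,
    S.ncard_normSet_ramified (nonZeroDivisors.ne_zero I.2) hp hP hpP n]

theorem opT_theta_inert (hf : ∀ (I : (Ideal R)⁰) (Q : PosForm D),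
      f (ClassGroup.mk0 I) = ⟦Q⟧ ↔ S.IsNormForm (I : Ideal R) Q)
    (hD : e ^ 2 + 4 * k = D) (he : e = 0 ∨ e = 1) {p : ℕ} (hp : p.Prime) (h : FormClass D)
    (hpP : (Ideal.span {(p : R)}).IsPrime) : opT D p (theta h) = 0 := by
  obtain ⟨I, hI⟩ := ClassGroup.mk0_surjective (f.symm h)
  obtain rfl : f (ClassGroup.mk0 I) = h := by rw [hI, Equiv.apply_symm_apply]
  ext n
  have key := S.ncard_normSet_inert (nonZeroDivisors.ne_zero I.2) hp hpP n
  simp only [coeff_opT, coeff_theta, (rep_classGroup hf _ _).1,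
    S.kroneckerSym_of_inert hD he hp hpP, key, map_zero]
  split_ifs <;> simp

/-- Multiplication by `c` permutes the classes. -/
theorem sum_theta_mul (f : ClassGroup R ≃ FormClass D) (c : ClassGroup R) :
    ∑ h : FormClass D, theta (f (f.symm h * c)) = ∑ h : FormClass D, theta h :=
  Equiv.sum_comp ((f.symm.trans (Equiv.mulRight c)).trans f) theta

theorem opT_sum_theta (hf : ∀ (I : (Ideal R)⁰) (Q : PosForm D),
      f (ClassGroup.mk0 I) = ⟦Q⟧ ↔ S.IsNormForm (I : Ideal R) Q)
    (hD : e ^ 2 + 4 * k = D) (he : e = 0 ∨ e = 1) {p : ℕ} (hp : p.Prime) :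
    opT D p (∑ h : FormClass D, theta h) =
      (1 + kroneckerSym D p) • ∑ h : FormClass D, theta h := by
  rw [opT_sum]
  rcases S.isPrime_or_exists_mul hp with hpP | ⟨P, P', hP, hP', hpP⟩
  · simp [opT_theta_inert hf hD he hp _ hpP, S.kroneckerSym_of_inert hD he hp hpP]
  · obtain ⟨hP0, hP0'⟩ := ne_bot_of_span_eq_mul hp hpP
    have mem := mem_nonZeroDivisors_of_ne_zero (M₀ := Ideal R) hP0
    have mem' := mem_nonZeroDivisors_of_ne_zero (M₀ := Ideal R) hP0'
    rcases eq_or_ne P P' with rfl | hne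
    · rw [← pow_two] at hpP
      have key := fun h => (opT_theta_ramified hf hD he hp h (P := ⟨P, mem⟩) hP hpP)
      simp only [(key _).1, (key _).2, sum_theta_mul,
        S.kroneckerSym_of_ramified hD he hp hP hpP, add_zero, one_smul]
    · have key := fun h => opT_theta_split hf hD he hp h (P := ⟨P, mem⟩) (P' := ⟨P', mem'⟩) hP hP'
        (fun h => hne (congrArg Subtype.val h)) hpP
      simp only [key, Finset.sum_add_distrib, sum_theta_mul,
        S.kroneckerSym_of_split hD he hp hP hP' hne hpP, add_smul, one_smul]

variable (S) in
theorem isNormForm_top (hD : e ^ 2 + 4 * k = D) (hneg : D < 0) :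
    S.IsNormForm ⊤ (principalForm hD hneg) := by
  refine ⟨S.elt 1 0, S.elt 0 1, by simp, fun z => ?_, fun x y => ?_⟩
  · obtain ⟨x, y, rfl⟩ := S.exists_eq_elt z
    simp only [Submodule.mem_top, true_iff]
    exact ⟨x, y, by simp [elt]⟩
  · rw [intCast_mul_elt, intCast_mul_elt, elt_add, norm_elt]
    simp [PosForm.eval, principalForm]
    ring

theorem totalRep_one (hf : ∀ (I : (Ideal R)⁰) (Q : PosForm D),
      f (ClassGroup.mk0 I) = ⟦Q⟧ ↔ S.IsNormForm (I : Ideal R) Q)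
    (hD : e ^ 2 + 4 * k = D) (hneg : D < 0) (he : e = 0 ∨ e = 1) : totalRep D 1 = wNum D := by
  rw [totalRep, Finset.sum_eq_single (f 1)]
  · have h1 : f (ClassGroup.mk0 1) = ⟦principalForm hD hneg⟧ := by
      rw [hf, Submonoid.coe_one, Ideal.one_eq_top]
      exact S.isNormForm_top hD hneg
    rw [map_one] at h1
    rw [h1, ← rep_one_principalForm hD hneg he]
    rfl
  -- An element `z ∈ I` with `N(z) = N(I)` generates `I`, so a class that represents `1` is
  -- principal.
  · intro h _ hne
    obtain ⟨I, hI⟩ := ClassGroup.mk0_surjective (f.symm h)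
    obtain rfl : f (ClassGroup.mk0 I) = h := by rw [hI, Equiv.apply_symm_apply]
    rw [(rep_classGroup hf I 1).1, Set.ncard_eq_zero (rep_classGroup hf I 1).2,
      Set.eq_empty_iff_forall_notMem]
    intro z hz
    obtain ⟨hzI, hzn⟩ := mem_normSet.mp hz
    apply hne
    congr 1
    obtain ⟨J, hJ⟩ := Ideal.dvd_span_singleton.mpr hzI
    have hJn : Ideal.absNorm J = 1 := by
      have := congrArg Ideal.absNorm hJ
      rw [Ideal.absNorm_span_singleton, hzn, map_mul, ← Nat.cast_mul, Int.natAbs_natCast] at this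
      exact (Nat.eq_of_mul_eq_mul_left (Ideal.absNorm_pos_of_nonZeroDivisors I) this).symm
    rw [Ideal.absNorm_eq_one_iff] at hJn
    rw [hJn, Ideal.mul_top] at hJ
    exact (ClassGroup.mk0_eq_one_iff I.2).mpr ⟨z, hJ.symm⟩
  · simp

theorem totalRep_eq (hf : ∀ (I : (Ideal R)⁰) (Q : PosForm D),
      f (ClassGroup.mk0 I) = ⟦Q⟧ ↔ S.IsNormForm (I : Ideal R) Q)
    (hD : e ^ 2 + 4 * k = D) (he : e = 0 ∨ e = 1) {p : ℕ} (hp : p.Prime) (n : ℕ) :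
    (totalRep D (p * n) : ℤ)
        + kroneckerSym D p * (if p ∣ n then (totalRep D (n / p) : ℤ) else 0)
      = (1 + kroneckerSym D p) * (totalRep D n : ℤ) := by
  have h := congrArg (PowerSeries.coeff n) (opT_sum_theta hf hD he hp)
  rw [coeff_opT, coeff_sum_theta, coeff_sum_theta, map_zsmul, coeff_sum_theta,
    smul_eq_mul] at h
  exact h

/-- Both sides satisfy the same recursion, which determines the value at `pm` from those at `m` and
`m/p`. -/
theorem totalRep_eq_sum_divisors (hf : ∀ (I : (Ideal R)⁰) (Q : PosForm D),
      f (ClassGroup.mk0 I) = ⟦Q⟧ ↔ S.IsNormForm (I : Ideal R) Q)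
    (hD : e ^ 2 + 4 * k = D) (hneg : D < 0) (he : e = 0 ∨ e = 1) (n : ℕ) (hn : 0 < n) :
    (totalRep D n : ℤ) = (wNum D : ℤ) * ∑ t ∈ n.divisors, kroneckerSym D t := by
  induction n using Nat.strong_induction_on with
  | _ n ih =>
    rcases eq_or_ne n 1 with rfl | h1
    · simp [totalRep_one hf hD hneg he, kroneckerSym_one]
    · obtain ⟨p, hp, m, rfl⟩ := Nat.exists_prime_and_dvd h1
      have hm : 0 < m := Nat.pos_of_mul_pos_left hn
      have a1 := totalRep_eq hf hD he hp m
      have a2 := sum_divisors_kroneckerSym_mul D hp hm.ne'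
      rw [ih m (lt_mul_of_one_lt_left hm hp.one_lt) hm] at a1
      split_ifs at a1 a2 with hpm
      · have hlt : m / p < p * m :=
          (Nat.div_le_self m p).trans_lt (lt_mul_of_one_lt_left hm hp.one_lt)
        rw [ih (m / p) hlt (Nat.div_pos (Nat.le_of_dvd hm hpm) hp.pos)] at a1
        linear_combination a1 - (wNum D : ℤ) * a2
      · linear_combination a1 - (wNum D : ℤ) * a2

end Hecke

end QuadBasis

end HeckeTheta

end

open HeckeTheta in
theorem proposition2p1 (D : ℤ) (hfund : IsFundamentalDiscriminant D) (hneg : D < 0) :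
    -- the identity for the coefficients
    (∀ p : ℕ, p.Prime → ∀ n : ℕ,
      (totalRep D (p * n) : ℤ)
          + kroneckerSym D p * (if p ∣ n then (totalRep D (n / p) : ℤ) else 0)
        = (1 + kroneckerSym D p) * (totalRep D n : ℤ)) ∧
    -- the sum of all theta series is an eigenform of every Hecke operator
    ((∑ h : FormClass D, theta h) ≠ 0 ∧
      ∀ p : ℕ, p.Prime →
        opT D p (∑ h : FormClass D, theta h)
          = (1 + kroneckerSym D p) • ∑ h : FormClass D, theta h) ∧
    -- Gauss's formula
    (∀ n : ℕ, 0 < n →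
      (totalRep D n : ℤ) = (wNum D : ℤ) * ∑ t ∈ n.divisors, kroneckerSym D t) ∧
    -- the action on the individual theta series, through the correspondence of ideal classes
    -- and form classes
    ∃ e : ClassGroup (𝓞 (quadField D)) ≃ FormClass D,
      (∀ (I : (Ideal (𝓞 (quadField D)))⁰) (Q : PosForm D),
        e (ClassGroup.mk0 I) = ⟦Q⟧ ↔ IsIdealForm (I : Ideal (𝓞 (quadField D))) Q) ∧
      ∀ p : ℕ, p.Prime → ∀ h : FormClass D,
        (∀ P P' : (Ideal (𝓞 (quadField D)))⁰,
          (P : Ideal (𝓞 (quadField D))).IsPrime → (P' : Ideal (𝓞 (quadField D))).IsPrime →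
          P ≠ P' →
          Ideal.span {(p : 𝓞 (quadField D))} = (P : Ideal (𝓞 (quadField D))) * P' →
            opT D p (theta h)
              = theta (e (e.symm h * ClassGroup.mk0 P))
                + theta (e (e.symm h * ClassGroup.mk0 P'))) ∧
        (∀ P : (Ideal (𝓞 (quadField D)))⁰,
          (P : Ideal (𝓞 (quadField D))).IsPrime →
          Ideal.span {(p : 𝓞 (quadField D))} = (P : Ideal (𝓞 (quadField D))) ^ 2 →
            opT D p (theta h) = opU p (theta h) ∧
            opU p (theta h) = theta (e (e.symm h * ClassGroup.mk0 P))) ∧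
        ((Ideal.span {(p : 𝓞 (quadField D))}).IsPrime →
          opT D p (theta h) = 0) := by
  obtain ⟨e, k, hD, he⟩ : ∃ e k : ℤ, e ^ 2 + 4 * k = D ∧ (e = 0 ∨ e = 1) := by
    rcases hfund with ⟨h, -⟩ | ⟨m, h, -⟩
    · exact ⟨1, D / 4, by omega, Or.inr rfl⟩
    · exact ⟨0, m, by omega, Or.inl rfl⟩
  obtain ⟨S, hS⟩ := exists_quadBasis hfund hneg hD he
  obtain ⟨f, hf⟩ := S.exists_classGroup_equiv hD hneg
  refine ⟨fun p hp n => QuadBasis.totalRep_eq hf hD he hp n,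
    ⟨fun h0 => ?_, fun p hp => QuadBasis.opT_sum_theta hf hD he hp⟩,
    QuadBasis.totalRep_eq_sum_divisors hf hD hneg he, f,
    fun I Q => (hf I Q).trans (isIdealForm_iff hneg hS I Q).symm, fun p hp h =>
    ⟨fun P P' hP hP' hne hpP => QuadBasis.opT_theta_split hf hD he hp h hP hP' hne hpP,
      fun P hP hpP => QuadBasis.opT_theta_ramified hf hD he hp h hP hpP,
      fun hpP => QuadBasis.opT_theta_inert hf hD he hp h hpP⟩⟩
  -- The sum of theta series is non-zero because its coefficient at `q` is `w`.
  have h1 := coeff_sum_theta D 1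
  rw [h0, map_zero, QuadBasis.totalRep_one hf hD hneg he] at h1
  have hw : wNum D ≠ 0 := by
    rw [wNum]; split_ifs <;> norm_num
  exact hw (by exact_mod_cast h1.symm)
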